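/- Let $H$ be a finite dimensional $C^*$-Hopf algebra, i.e. a finite dimensional $C^*$-algebra with unital $*$-homomorphisms $\Delta:H\to H\otimes H$, $\epsilon:H\to\mathbf C$ (coassociative, counital) and an antipode $S$ satisfying $S(S(h^*)^*)=h$; write $\Delta(h)=h_{(1)}\otimes h_{(2)}$. Let $H^0$ be its dual $C^*$-Hopf algebra: the linear functionals on $H$ with $(\phi\psi)(h)=\phi(h_{(1)})\psi(h_{(2)})$, $\phi^*(h)=\overline{\phi(S(h)^*)}$, unit $1^0=\epsilon$, counit $\epsilon^0(\phi)=\phi(1)$ and comultiplication $\Delta^0(\phi)(h\otimes k)=\phi(hk)$. Let $\tau\in H^0$ be the Haar trace on $H$, i.e. the unique element with $\tau(1)=1$ and $\phi\tau=\tau\phi=\phi(1)\tau$ for all $\phi\in H^0$. Let $A$ be a (possibly non-unital) $C^*$-algebra with multiplier algebra $M(A)$, and let $\rho$ be a coaction of $H^0$ on $A$, i.e. a $*$-homomorphism $\rho:A\to A\otimes H^0$ such that the closed linear span of $\rho(A)(A\otimes H^0)$ is $A\otimes H^0$, $(\mathrm{id}\otimes\epsilon^0)\circ\rho=\mathrm{id}$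 and $(\rho\otimes\mathrm{id})\circ\rho=(\mathrm{id}\otimes\Delta^0)\circ\rho$. Put $h\cdot a=(\mathrm{id}\otimes h)(\rho(a))$. The crossed product $A\rtimes_\rho H$ is the $C^*$-algebra with underlying space $A\otimes H$, with $a\rtimes h$ denoting $a\otimes h$, and operations $(a\rtimes h)(b\rtimes k)=a(h_{(1)}\cdot b)\rtimes h_{(2)}k$ and $(a\rtimes h)^*=(h_{(1)}^*\cdot a^*)\rtimes h_{(2)}^*$. Identify $A$ with its image under $a\mapsto a\rtimes 1$, and accordingly $M(A)$ with a subalgebra of $M(A\rtimes_\rho H)$. Let $E_1^\rho:A\rtimes_\rho H\to A$, $E_1^\rho(a\rtimes h)=\tau(h)a$, be the canonical conditional expectation. Here a conditional expectation from $A\rtimes_\rho H$ onto $A$ is a positive linear $A$-bimodule map that restricts to the identity on $A$. We call $\rho$ free if every $x\in M(A)\otimes H^0$ with $x\rho(a)=(a\otimes 1^0)x$ for all $a\in A$ lies in $(A'\cap M(A))\otimes\mathbf C\tau$. Then the following conditions are equivalent: (1) $\rho$ is free; (2) $A'\cap M(A\rtimes_\rho H)=A'\cap M(A)$; (3) $E_1^\rho$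 is the unique conditional expectation from $A\rtimes_\rho H$ onto $A$. -/

import Mathlib

open scoped TensorProduct MultiplierAlgebra ComplexConjugate

namespace CStarCoaction

open Coalgebra

/-! ### C*-Hopf algebras and their duals -/

/-- A C*-Hopf algebra structure on a unital C*-algebra `H` (used below only for finite dimensional
`H`): a Hopf algebra whose comultiplication `Δ : H → H ⊗ H` and counit `ε : H → ℂ` are unital
`*`-homomorphisms and whose antipode satisfies `S(S(h*)*) = h`. Coassociativity and the counit law
are those of Mathlib's `Coalgebra`. -/
class CStarHopfAlgebra (H : Type*) [CStarAlgebra H] extends Coalgebra ℂ H where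
  counit_one : counit (1 : H) = 1
  counit_mul (h k : H) : counit (h * k) = counit h * counit k
  counit_star (h : H) : counit (star h) = conj (counit h)
  comul_one : comul (1 : H) = 1
  comul_mul (h k : H) : comul (h * k) = comul h * comul k
  comul_star (h : H) : comul (star h) = star (comul h)
  /-- The antipode `S`. -/
  antipode : H →ₗ[ℂ] H
  mul_antipode_rTensor_comul :
    LinearMap.mul' ℂ H ∘ₗ antipode.rTensor H ∘ₗ comul = Algebra.linearMap ℂ H ∘ₗ counit
  mul_antipode_lTensor_comul :
    LinearMap.mul' ℂ H ∘ₗ antipode.lTensor H ∘ₗ comul = Algebra.linearMap ℂ H ∘ₗ counit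
  antipode_star (h : H) : antipode (star (antipode (star h))) = h

/-- A C*-Hopf algebra is a Hopf algebra in the sense of Mathlib. -/
noncomputable instance CStarHopfAlgebra.toHopfAlgebra (H : Type*) [CStarAlgebra H]
    [CStarHopfAlgebra H] : HopfAlgebra ℂ H where
  counit_one := CStarHopfAlgebra.counit_one
  mul_compr₂_counit := by ext h k; exact CStarHopfAlgebra.counit_mul h k
  comul_one := CStarHopfAlgebra.comul_one
  mul_compr₂_comul := by ext h k; exact CStarHopfAlgebra.comul_mul h k
  antipode := CStarHopfAlgebra.antipode
  mul_antipode_rTensor_comul := CStarHopfAlgebra.mul_antipode_rTensor_comul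
  mul_antipode_lTensor_comul := CStarHopfAlgebra.mul_antipode_lTensor_comul

/-- The dual `H⁰` of `H`: the linear functionals on `H`, with the product
`(φ ψ)(h) = φ(h₁) ψ(h₂)`, the unit `ε`, the involution `φ*(h) = conj (φ (S(h)*))`, the counit
`ε⁰(φ) = φ(1)` and the comultiplication `Δ⁰(φ)(h ⊗ k) = φ(h k)`. -/
def DualHopf (H : Type*) [CStarAlgebra H] [CStarHopfAlgebra H] : Type _ := Module.Dual ℂ H

namespace DualHopf
variable {H : Type*} [CStarAlgebra H] [CStarHopfAlgebra H]

instance : FunLike (DualHopf H) H ℂ := inferInstanceAs (FunLike (H →ₗ[ℂ] ℂ) H ℂ)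
instance : LinearMapClass (DualHopf H) ℂ H ℂ :=
  inferInstanceAs (LinearMapClass (H →ₗ[ℂ] ℂ) ℂ H ℂ)

variable (H) in
/-- `H⁰` is Mathlib's convolution algebra of linear maps `H → ℂ`. (Its involution is not the one
of Mathlib on that algebra, whence the separate type.) -/
def equivConv : DualHopf H ≃ WithConv (H →ₗ[ℂ] ℂ) := (WithConv.equiv (H →ₗ[ℂ] ℂ)).symm

noncomputable instance : Ring (DualHopf H) := (equivConv H).ring
noncomputable instance : Algebra ℂ (DualHopf H) := (equivConv H).algebra ℂ

variable (H) in
/-- `H⁰` is the linear dual of `H`. -/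
noncomputable def toDual : DualHopf H ≃ₗ[ℂ] Module.Dual ℂ H where
  toFun φ := φ
  invFun φ := φ
  map_add' _ _ := rfl
  map_smul' _ _ := rfl

instance [FiniteDimensional ℂ H] : FiniteDimensional ℂ (DualHopf H) :=
  (toDual H).symm.finiteDimensional

/-- Evaluation of functionals at `h`. -/
noncomputable def eval (h : H) : DualHopf H →ₗ[ℂ] ℂ := LinearMap.applyₗ h ∘ₗ (toDual H).toLinearMap

theorem eval_apply (h : H) (φ : DualHopf H) : eval h φ = φ h := rfl
theorem add_apply (φ ψ : DualHopf H) (h : H) : (φ + ψ) h = φ h + ψ h := rfl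
theorem smul_apply (c : ℂ) (φ : DualHopf H) (h : H) : (c • φ) h = c * φ h := rfl
theorem one_apply (h : H) : (1 : DualHopf H) h = Coalgebra.counit (R := ℂ) h := rfl
theorem mul_apply (φ ψ : DualHopf H) (h : H) {ι : Type*} (r : Repr ℂ h ι) :
    (φ * ψ) h = ∑ i ∈ r.index, φ (r.left i) * ψ (r.right i) :=
  r.convMul_apply (equivConv H φ) (equivConv H ψ) 

theorem ext {φ ψ : DualHopf H} (h : ∀ x : H, φ x = ψ x) : φ = ψ := LinearMap.ext h

noncomputable instance : Star (DualHopf H) where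
  star φ := 
    { toFun := fun h ↦ conj (φ (star (CStarHopfAlgebra.antipode h)))
      map_add' := by intros; simp
      map_smul' := by intros; simp }

noncomputable instance : StarAddMonoid (DualHopf H) where
  star_involutive φ := ext fun h ↦ by
    change conj (conj (φ (star (CStarHopfAlgebra.antipode (star (CStarHopfAlgebra.antipode h)))))) = φ h
    have := CStarHopfAlgebra.antipode_star (star h)
    rw [star_star] at this
    rw [this]
    simp
  star_add φ ψ := ext fun h ↦ map_add (starRingEnd ℂ) _ _

instance : StarModule ℂ (DualHopf H) where
  star_smul _ _ := ext fun _ ↦ map_mul (starRingEnd ℂ) _ _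

/-- The counit `ε⁰(φ) = φ(1)` of `H⁰`. -/
noncomputable def counit : DualHopf H →ₗ[ℂ] ℂ := eval 1

/-- The comultiplication of `H⁰`, the transpose of the product of `H`:
`Δ⁰(φ)(h ⊗ k) = φ(h k)`. -/
noncomputable def comul [FiniteDimensional ℂ H] : DualHopf H →ₗ[ℂ] DualHopf H ⊗[ℂ] DualHopf H :=
  (TensorProduct.congr (toDual H).symm (toDual H).symm).toLinearMap ∘ₗ
    (TensorProduct.dualDistribEquiv ℂ H H).symm.toLinearMap ∘ₗ
      (LinearMap.mul' ℂ H).dualMap ∘ₗ (toDual H).toLinearMap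

theorem eval_eval_comul [FiniteDimensional ℂ H] (h k : H) (φ : DualHopf H) :
   TensorProduct.lid ℂ ℂ (TensorProduct.map (eval h) (eval k) (comul φ)) = φ (h * k) := by
  have key : ∀ z : Module.Dual ℂ H ⊗[ℂ] Module.Dual ℂ H,
      TensorProduct.lid ℂ ℂ (TensorProduct.map (eval h) (eval k)
        (TensorProduct.congr (toDual H).symm (toDual H).symm z)) =
      TensorProduct.dualDistribEquiv ℂ H H z (h ⊗ₜ k) := by
    intro z
    induction z with
    | zero => simp
    | add x y hx hy => simp only [map_add, hx, hy, LinearMap.add_apply]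
    | tmul f g => rfl
  have := key ((TensorProduct.dualDistribEquiv ℂ H H).symm
    ((LinearMap.mul' ℂ H).dualMap (toDual H φ)))
  rw [LinearEquiv.apply_symm_apply] at this
  exact this

end DualHopf

/-! ### The Haar trace

The lemmas of this part serve the existence of the distinguished projection `τ` of `H⁰`. -/

theorem exists_orthonormal_basis_of_core {V : Type*} [AddCommGroup V] [Module ℂ V]
    [FiniteDimensional ℂ V] (c : InnerProductSpace.Core ℂ V) :
    ∃ (n : ℕ) (b : Module.Basis (Fin n) ℂ V), ∀ i j, c.inner (b i) (b j) = if i = j then 1 else 0 := by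
  let _ := c.toNormedAddCommGroup
  let _ : InnerProductSpace ℂ V := InnerProductSpace.ofCore c.toCore
  refine ⟨_, (stdOrthonormalBasis ℂ V).toBasis, fun i j ↦ ?_⟩
  rw [OrthonormalBasis.coe_toBasis]
  exact orthonormal_iff_ite.mp (stdOrthonormalBasis ℂ V).orthonormal i j

section
variable {H : Type*} [CStarAlgebra H] [FiniteDimensional ℂ H]

theorem mem_spectrum_of_mem_roots (x : H) {μ : ℂ}
    (hμ : μ ∈ (LinearMap.mulLeft ℂ x).charpoly.roots) : μ ∈ spectrum ℂ x := by
  have h := (Module.End.hasEigenvalue_iff_isRoot_charpoly (LinearMap.mulLeft ℂ x) μ).mpr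
    (Polynomial.isRoot_of_mem_roots hμ)
  obtain ⟨v, hv⟩ := h.exists_hasEigenvector
  intro hu
  have h1 : x * v = μ • v := hv.apply_eq_smul
  have h2 : (algebraMap ℂ H μ - x) * v = 0 := by
    rw [sub_mul, h1, Algebra.algebraMap_eq_smul_one, smul_one_mul, sub_self]
  exact hv.2 ((hu.mul_right_eq_zero).mp h2)

theorem exists_ker_of_mem_spectrum {x : H} {μ : ℂ} (hμ : μ ∈ spectrum ℂ x) :
    ∃ v ≠ 0, x * v = μ • v := by
  by_contra! hcon
  apply hμ
  have hinj : Function.Injective (LinearMap.mulLeft ℂ (algebraMap ℂ H μ - x)) := by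
    rw [← LinearMap.ker_eq_bot, LinearMap.ker_eq_bot']
    intro v hv
    by_contra hv0
    refine hcon v hv0 ?_
    rw [LinearMap.mulLeft_apply, sub_mul, Algebra.algebraMap_eq_smul_one, smul_one_mul,
      sub_eq_zero] at hv
    exact hv.symm
  have hsurj := LinearMap.surjective_of_injective hinj
  obtain ⟨w, hw⟩ := hsurj 1
  rw [LinearMap.mulLeft_apply] at hw
  have hw' : w * (algebraMap ℂ H μ - x) = 1 := by
    apply hinj
    simp only [LinearMap.mulLeft_apply]
    rw [← mul_assoc, hw, one_mul, mul_one]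
  exact ⟨⟨_, w, hw, hw'⟩, rfl⟩

theorem trace_eq (x : H) : LinearMap.trace ℂ H (LinearMap.mulLeft ℂ x) =
    (LinearMap.mulLeft ℂ x).charpoly.roots.sum :=
  Module.End.trace_eq_sum_roots_charpoly_of_splits (IsAlgClosed.splits _)

theorem exists_faithful_functional [Nontrivial H] :
    ∃ ω : H →ₗ[ℂ] ℂ, ω 1 = 1 ∧ (∀ x, ω (star x) = conj (ω x)) ∧
      ∀ x ≠ 0, 0 < (ω (star x * x)).re := by
  let t : H →ₗ[ℂ] ℂ := LinearMap.trace ℂ H ∘ₗ LinearMap.mul ℂ H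
  have ht : ∀ x, t x = (LinearMap.mulLeft ℂ x).charpoly.roots.sum := trace_eq
  have hsa : ∀ x, IsSelfAdjoint x → (t x).im = 0 := by
    intro x hx
    rw [ht]
    have : ∀ s : Multiset ℂ, (∀ μ ∈ s, μ ∈ spectrum ℂ x) → s.sum.im = 0 := by
      intro s
      induction s using Multiset.induction_on with
      | empty => simp
      | cons a s ih =>
        intro h
        rw [Multiset.sum_cons, Complex.add_im, ih fun μ hμ ↦ h μ (Multiset.mem_cons_of_mem hμ),
          hx.mem_spectrum_eq_re (h a (Multiset.mem_cons_self a s))]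
        simp
    exact this _ fun μ hμ ↦ mem_spectrum_of_mem_roots x hμ
  have hstar : ∀ x, t (star x) = conj (t x) := by
    intro x
    have h1 := hsa (realPart x : H) (realPart x).2
    have h2 := hsa (imaginaryPart x : H) (imaginaryPart x).2
    have h3 := congrArg t (realPart_add_I_smul_imaginaryPart x)
    have h4 := congrArg t (congrArg star (realPart_add_I_smul_imaginaryPart x))
    rw [star_add, star_smul, (realPart x).2.star_eq, (imaginaryPart x).2.star_eq] at h4
    rw [map_add, map_smul] at h3 h4
    rw [← h3, ← h4]
    apply Complex.ext <;> simp [h1, h2]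
  have hpos : ∀ x ≠ 0, 0 < (t (star x * x)).re := by
    intro x hx
    have hsp : ∀ μ ∈ spectrum ℂ (star x * x), 0 ≤ μ.re := by
      intro μ hμ
      have hs : IsSelfAdjoint (star x * x) := .star_mul_self x
      have := hs.mem_spectrum_eq_re hμ
      rw [this] at hμ
      exact spectrum_star_mul_self_nonneg (b := x) μ.re ((spectrum.algebraMap_mem_iff ℂ).mp hμ)
    rw [ht]
    have key : ∀ s : Multiset ℂ, (∀ μ ∈ s, 0 ≤ μ.re) → (0 ≤ s.sum.re ∧ ∀ μ ∈ s, μ.re ≤ s.sum.re) := by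
      intro s
      induction s using Multiset.induction_on with
      | empty => simp
      | cons a s ih =>
        intro h
        have ha := h a (Multiset.mem_cons_self a s)
        obtain ⟨i1, i2⟩ := ih fun μ hμ ↦ h μ (Multiset.mem_cons_of_mem hμ)
        rw [Multiset.sum_cons, Complex.add_re]
        refine ⟨by linarith, fun μ hμ ↦ ?_⟩
        rcases Multiset.mem_cons.mp hμ with rfl | hμ
        · linarith
        · linarith [i2 μ hμ]
    obtain ⟨k1, k2⟩ := key _ fun μ hμ ↦ hsp μ (mem_spectrum_of_mem_roots _ hμ)
    refine lt_of_le_of_ne k1 fun h0 ↦ hx ?_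
    have hs : IsSelfAdjoint (star x * x) := .star_mul_self x
    have hz : ∀ μ ∈ spectrum ℂ (star x * x), μ = 0 := by
      intro μ hμ
      obtain ⟨v, hv, hxv⟩ := exists_ker_of_mem_spectrum hμ
      have hroot : μ ∈ (LinearMap.mulLeft ℂ (star x * x)).charpoly.roots := by
        rw [Polynomial.mem_roots (LinearMap.charpoly_monic _).ne_zero,
          ← Module.End.hasEigenvalue_iff_isRoot_charpoly]
        exact Module.End.hasEigenvalue_of_hasEigenvector
          (Module.End.hasEigenvector_iff.mpr ⟨Module.End.mem_eigenspace_iff.mpr hxv, hv⟩)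
      have := k2 μ hroot
      have h5 := hsp μ hμ
      rw [hs.mem_spectrum_eq_re hμ, show μ.re = 0 by linarith]
      simp
    have hr : spectralRadius ℂ (star x * x) = 0 := by
      rw [spectralRadius]
      simp only [ENNReal.iSup_eq_zero]
      intro μ hμ
      simp [hz μ hμ]
    rw [hs.spectralRadius_eq_nnnorm] at hr
    have : star x * x = 0 := by simpa using hr
    exact (CStarRing.star_mul_self_eq_zero_iff x).mp this
  have h1 : 0 < (t 1).re := by simpa using hpos 1 one_ne_zero
  have h1' : conj (t 1) = t 1 := by rw [← hstar, star_one]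
  have h1r : t 1 = ((t 1).re : ℂ) := (Complex.conj_eq_iff_real.mp h1').elim fun r hr ↦ by simp [hr]
  refine ⟨(((t 1).re⁻¹ : ℝ) : ℂ) • t, ?_, fun x ↦ ?_, fun x hx ↦ ?_⟩
  · rw [LinearMap.smul_apply, smul_eq_mul]
    nth_rw 2 [h1r]
    rw [← Complex.ofReal_mul, inv_mul_cancel₀ h1.ne', Complex.ofReal_one]
  · simp [hstar]
  · rw [LinearMap.smul_apply, smul_eq_mul, Complex.re_ofReal_mul]
    exact mul_pos (inv_pos.mpr h1) (hpos x hx)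

theorem exists_min (x : H) [Nontrivial H] (hx : IsSelfAdjoint x) :
    ∃ (μ : ℝ) (d v : H), v ≠ 0 ∧ x = (μ : ℂ) • 1 + star d * d ∧ star d * d * v = 0 := by
  let _ := CStarAlgebra.spectralOrder H
  let _ := CStarAlgebra.spectralOrderedRing H
  obtain ⟨μ, hμ, hmin⟩ := (ContinuousFunctionalCalculus.isCompact_spectrum (R := ℝ) x).exists_isLeast
    (ContinuousFunctionalCalculus.spectrum_nonempty x hx)
  have hle : algebraMap ℝ H μ ≤ x := (algebraMap_le_iff_le_spectrum (a := x)).mpr fun y hy ↦ hmin hy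
  obtain ⟨d, hd⟩ := CStarAlgebra.nonneg_iff_eq_star_mul_self.mp (sub_nonneg.mpr hle)
  have hμ' : (μ : ℂ) ∈ spectrum ℂ x := (spectrum.algebraMap_mem_iff ℂ).mpr hμ
  obtain ⟨v, hv, hxv⟩ := exists_ker_of_mem_spectrum hμ'
  have e : algebraMap ℝ H μ = (μ : ℂ) • 1 := by
    rw [Algebra.algebraMap_eq_smul_one]; simp
  refine ⟨μ, d, v, hv, ?_, ?_⟩
  · rw [← hd, e]; abel
  · rw [← hd, e, sub_mul, hxv]; simp

/-- The functional `ω ⊗ ω`. -/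
noncomputable def ampl (ω : H →ₗ[ℂ] ℂ) : H ⊗[ℂ] H →ₗ[ℂ] ℂ :=
  LinearMap.mul' ℂ ℂ ∘ₗ TensorProduct.map ω ω

theorem ampl_pos (ω : H →ₗ[ℂ] ℂ) (hs : ∀ x, ω (star x) = conj (ω x))
    (hp : ∀ x ≠ 0, 0 < (ω (star x * x)).re) (z : H ⊗[ℂ] H) :
    0 ≤ (ampl ω (star z * z)).re ∧ (ampl ω (star z * z) = 0 → z = 0) := by
  have hp' : ∀ x, 0 ≤ (ω (star x * x)).re := fun x ↦ by
    by_cases h : x = 0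
    · simp [h]
    · exact (hp x h).le
  let c : InnerProductSpace.Core ℂ H :=
    { inner := fun x y ↦ ω (star x * y)
      conj_inner_symm := fun x y ↦ by rw [← hs, star_mul, star_star]
      re_inner_nonneg := fun x ↦ hp' x
      add_left := fun x y z ↦ by simp [add_mul]
      smul_left := fun x y r ↦ by simp
      definite := fun x hx ↦ by
        by_contra h
        have := hp x h
        rw [hx] at this
        simp at this }
  obtain ⟨n, b, hb⟩ := exists_orthonormal_basis_of_core c
  have hb' : ∀ i j, ω (star (b i) * b j) = if i = j then 1 else 0 := hb
  obtain ⟨a, rfl⟩ : ∃ a : Fin n → H, z = ∑ i, a i ⊗ₜ[ℂ] b i := by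
    induction z with
    | zero => exact ⟨0, by simp⟩
    | add x y hx hy =>
      obtain ⟨f, rfl⟩ := hx
      obtain ⟨g, rfl⟩ := hy
      exact ⟨f + g, by simp [TensorProduct.add_tmul, Finset.sum_add_distrib]⟩
    | tmul x y =>
      refine ⟨fun i ↦ b.repr y i • x, ?_⟩
      simp only [TensorProduct.smul_tmul, ← TensorProduct.tmul_sum, b.sum_repr]
  have e : ampl ω (star (∑ i, a i ⊗ₜ[ℂ] b i) * ∑ i, a i ⊗ₜ[ℂ] b i) =
      ∑ i, ω (star (a i) * a i) := by
    rw [star_sum, Finset.sum_mul_sum, map_sum]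
    refine Finset.sum_congr rfl fun i _ ↦ ?_
    rw [map_sum]
    simp [ampl, hb']
  rw [e]
  refine ⟨?_, fun h0 ↦ ?_⟩
  · rw [Complex.re_sum]
    exact Finset.sum_nonneg fun i _ ↦ hp' _
  · have h1 := congrArg Complex.re h0
    rw [Complex.re_sum, Complex.zero_re, Finset.sum_eq_zero_iff_of_nonneg fun i _ ↦ hp' _] at h1
    refine Finset.sum_eq_zero fun i hi ↦ ?_
    have : a i = 0 := by
      by_contra h
      exact (hp _ h).ne' (h1 i hi)
    rw [this, TensorProduct.zero_tmul]

/-- The map `(id ⊗ ω) ∘ δ`. -/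
noncomputable def convRight (δ : H →ₐ[ℂ] H ⊗[ℂ] H) (ω : H →ₗ[ℂ] ℂ) : H →ₗ[ℂ] H :=
  (TensorProduct.rid ℂ H).toLinearMap ∘ₗ ω.lTensor H ∘ₗ δ.toLinearMap

theorem ampl_sandwich (ω : H →ₗ[ℂ] ℂ) (v : H) (z : H ⊗[ℂ] H) :
    ampl ω ((star v ⊗ₜ 1) * z * (v ⊗ₜ 1)) =
      ω (star v * TensorProduct.rid ℂ H (ω.lTensor H z) * v) := by
  induction z with
  | zero => simp
  | add x y hx hy => simp only [mul_add, add_mul, map_add, hx, hy]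
  | tmul x y => simp [ampl, mul_comm]

theorem exists_invariant [Nontrivial H] (ω : H →ₗ[ℂ] ℂ) (h1 : ω 1 = 1)
    (hs : ∀ x, ω (star x) = conj (ω x)) (hp : ∀ x ≠ 0, 0 < (ω (star x * x)).re)
    (δ : H →ₐ[ℂ] H ⊗[ℂ] H) (hδ : ∀ x, δ (star x) = star (δ x)) :
    ∃ τ : H →ₗ[ℂ] ℂ, τ 1 = 1 ∧ ∀ x, τ (convRight δ ω x) = τ x := by
  have hcs : ∀ z : H ⊗[ℂ] H, TensorProduct.rid ℂ H (ω.lTensor H (star z)) =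
      star (TensorProduct.rid ℂ H (ω.lTensor H z)) := by
    intro z
    induction z with
    | zero => simp
    | add x y hx hy => simp only [star_add, map_add, hx, hy]
    | tmul x y => simp [hs]
  have hcstar : ∀ x, convRight δ ω (star x) = star (convRight δ ω x) := by
    intro x
    change TensorProduct.rid ℂ H (ω.lTensor H (δ (star x))) = _
    rw [hδ, hcs]; rfl
  have hc1 : convRight δ ω 1 = 1 := by
    change TensorProduct.rid ℂ H (ω.lTensor H (δ 1)) = _
    rw [map_one, Algebra.TensorProduct.one_def]
    simp [h1]
  have hsa : ∀ x, IsSelfAdjoint x → x - convRight δ ω x ≠ 1 := by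
    intro x hx hcon
    obtain ⟨μ, d, v, hv, rfl, hdv⟩ := exists_min x hx
    rw [map_add, map_smul, hc1, add_sub_add_left_eq_sub] at hcon
    have hpos := (ampl_pos ω hs hp (δ d * (v ⊗ₜ 1))).1
    have e : star (δ d * (v ⊗ₜ[ℂ] (1 : H))) * (δ d * (v ⊗ₜ 1)) =
        (star v ⊗ₜ 1) * δ (star d * d) * (v ⊗ₜ 1) := by
      rw [map_mul, hδ, star_mul, TensorProduct.star_tmul, star_one]
      simp only [mul_assoc]
    rw [e, ampl_sandwich] at hpos
    change 0 ≤ (ω (star v * convRight δ ω (star d * d) * v)).re at hpos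
    rw [show convRight δ ω (star d * d) = star d * d - 1 by rw [← hcon]; abel, mul_assoc, sub_mul,
      hdv, zero_sub, one_mul, mul_neg, map_neg, Complex.neg_re] at hpos
    linarith [hp v hv]
  have hmem : (1 : H) ∉ LinearMap.range (LinearMap.id - convRight δ ω) := by
    rintro ⟨x, hx⟩
    simp only [LinearMap.sub_apply, LinearMap.id_apply] at hx
    have hx' : star x - convRight δ ω (star x) = 1 := by
      rw [hcstar, ← star_sub, hx, star_one]
    refine hsa ((1 / 2 : ℝ) • (x + star x)) ?_ ?_
    · rw [isSelfAdjoint_iff, star_smul, star_add, star_star, add_comm]; simp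
    · rw [LinearMap.map_smul_of_tower, ← smul_sub, map_add, add_sub_add_comm, hx, hx', ← two_smul ℝ,
        smul_smul]
      norm_num
  obtain ⟨f, hf1, hf⟩ := Submodule.exists_le_ker_of_notMem hmem
  refine ⟨(f 1)⁻¹ • f, by simp [hf1], fun x ↦ ?_⟩
  have := hf ⟨x, rfl⟩
  rw [LinearMap.mem_ker] at this
  simp only [LinearMap.sub_apply, LinearMap.id_apply, map_sub, sub_eq_zero] at this
  simp [this]

theorem fixed_scalar [Nontrivial H] (ω : H →ₗ[ℂ] ℂ) (h1 : ω 1 = 1)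
    (hs : ∀ x, ω (star x) = conj (ω x)) (hp : ∀ x ≠ 0, 0 < (ω (star x * x)).re)
    (δ : H →ₐ[ℂ] H ⊗[ℂ] H) (hδ : ∀ x, δ (star x) = star (δ x))
    (Ψ : H ⊗[ℂ] H →ₗ[ℂ] H ⊗[ℂ] H) (hΨ : ∀ u c, Ψ ((u ⊗ₜ 1) * δ c) = u ⊗ₜ c)
    (x : H) (hx : convRight δ ω x = x) : ∃ c : ℂ, x = c • 1 := by
  have hcs : ∀ z : H ⊗[ℂ] H, TensorProduct.rid ℂ H (ω.lTensor H (star z)) =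
      star (TensorProduct.rid ℂ H (ω.lTensor H z)) := by
    intro z
    induction z with
    | zero => simp
    | add x y hx hy => simp only [star_add, map_add, hx, hy]
    | tmul x y => simp [hs]
  have hcstar : ∀ x, convRight δ ω (star x) = star (convRight δ ω x) := by
    intro x
    change TensorProduct.rid ℂ H (ω.lTensor H (δ (star x))) = _
    rw [hδ, hcs]; rfl
  have hc1 : convRight δ ω 1 = 1 := by
    change TensorProduct.rid ℂ H (ω.lTensor H (δ 1)) = _
    rw [map_one, Algebra.TensorProduct.one_def]
    simp [h1]
  have hsa : ∀ x, IsSelfAdjoint x → convRight δ ω x = x → ∃ c : ℂ, x = c • 1 := by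
    intro x hx hxf
    obtain ⟨μ, d, v, hv, rfl, hdv⟩ := exists_min x hx
    refine ⟨μ, ?_⟩
    rw [map_add, map_smul, hc1, add_right_inj] at hxf
    have e : star (δ d * (v ⊗ₜ[ℂ] (1 : H))) * (δ d * (v ⊗ₜ 1)) =
        (star v ⊗ₜ 1) * δ (star d * d) * (v ⊗ₜ 1) := by
      rw [map_mul, hδ, star_mul, TensorProduct.star_tmul, star_one]
      simp only [mul_assoc]
    have h0 := (ampl_pos ω hs hp (δ d * (v ⊗ₜ 1))).2 (by
      rw [e, ampl_sandwich]
      change ω (star v * convRight δ ω (star d * d) * v) = 0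
      rw [hxf, mul_assoc, hdv]
      simp)
    have h2 : (star v ⊗ₜ 1) * δ (star d * d) = (0 : H ⊗[ℂ] H) := by
      have h3 : star (δ (star d) * (δ d * (v ⊗ₜ[ℂ] (1 : H)))) = 0 := by rw [h0]; simp
      rwa [← mul_assoc, ← map_mul, star_mul, ← hδ, star_mul, star_star, TensorProduct.star_tmul,
        star_one] at h3
    have h4 := hΨ (star v) (star d * d)
    rw [h2, map_zero] at h4
    have h5 : star d * d = 0 := by
      have h6 := congrArg (TensorProduct.lid ℂ H ∘ (ω ∘ₗ LinearMap.mulRight ℂ v).rTensor H) h4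
      simp only [Function.comp_apply, map_zero, LinearMap.rTensor_tmul, LinearMap.comp_apply,
        LinearMap.mulRight_apply, TensorProduct.lid_tmul] at h6
      refine (smul_eq_zero.mp h6.symm).resolve_left fun h7 ↦ ?_
      have := hp v hv
      rw [h7] at this
      simp at this
    rw [h5, add_zero]
  have h3 := realPart_add_I_smul_imaginaryPart x
  have hre : convRight δ ω (realPart x : H) = realPart x := by
    rw [realPart_apply_coe, LinearMap.map_smul_of_tower, map_add, hcstar, hx]
  have him : convRight δ ω (imaginaryPart x : H) = imaginaryPart x := by
    rw [imaginaryPart_apply_coe, map_smul, LinearMap.map_smul_of_tower, map_sub, hcstar, hx]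
  obtain ⟨p, hp'⟩ := hsa _ (realPart x).2 hre
  obtain ⟨q, hq⟩ := hsa _ (imaginaryPart x).2 him
  refine ⟨p + Complex.I * q, ?_⟩
  rw [← h3, hp', hq, add_smul, mul_smul]
end

section Haar
variable {H : Type*} [CStarAlgebra H] [CStarHopfAlgebra H]

/-- `Δ(h*) = h₁* ⊗ h₂*`. -/
noncomputable def reprStar (h : H) : Repr ℂ (star h) (H × H) where
  index := (ℛ ℂ h).index
  left i := star ((ℛ ℂ h).left i)
  right i := star ((ℛ ℂ h).right i)
  eq := by
    rw [CStarHopfAlgebra.comul_star, ← (ℛ ℂ h).eq, star_sum]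
    rfl

variable (H) in
/-- The comultiplication. -/
noncomputable def comulHom : H →ₐ[ℂ] H ⊗[ℂ] H := Bialgebra.comulAlgHom ℂ H

variable (H) in
/-- The opposite comultiplication. -/
noncomputable def comulOpHom : H →ₐ[ℂ] H ⊗[ℂ] H :=
  (Algebra.TensorProduct.comm ℂ H H).toAlgHom.comp (Bialgebra.comulAlgHom ℂ H)

theorem comulHom_apply (h : H) {ι : Type*} (r : Repr ℂ h ι) :
    comulHom H h = ∑ i ∈ r.index, r.left i ⊗ₜ[ℂ] r.right i := r.eq.symm

theorem comulOpHom_apply (h : H) {ι : Type*} (r : Repr ℂ h ι) :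
    comulOpHom H h = ∑ i ∈ r.index, r.right i ⊗ₜ[ℂ] r.left i := by
  change Algebra.TensorProduct.comm ℂ H H (comul h) = _
  rw [← r.eq, map_sum]; rfl

theorem comulHom_star (h : H) : comulHom H (star h) = star (comulHom H h) :=
  CStarHopfAlgebra.comul_star h

theorem comulOpHom_star (h : H) : comulOpHom H (star h) = star (comulOpHom H h) := by
  rw [comulOpHom_apply _ (reprStar h), comulOpHom_apply _ (ℛ ℂ h), star_sum]
  rfl

theorem convRight_comulHom (ω : H →ₗ[ℂ] ℂ) (h : H) {ι : Type*} (r : Repr ℂ h ι) :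
    convRight (comulHom H) ω h = ∑ i ∈ r.index, ω (r.right i) • r.left i := by
  simp [convRight, comulHom_apply h r]

theorem convRight_comulOpHom (ω : H →ₗ[ℂ] ℂ) (h : H) {ι : Type*} (r : Repr ℂ h ι) :
    convRight (comulOpHom H) ω h = ∑ i ∈ r.index, ω (r.left i) • r.right i := by
  simp [convRight, comulOpHom_apply h r]

theorem convRight_conv (ω τ : H →ₗ[ℂ] ℂ) (h : H) :
    convRight (comulHom H) ω (convRight (comulHom H) τ h) =
      convRight (comulHom H) (τ ∘ₗ convRight (comulOpHom H) ω) h := by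
  have key := congrArg (TensorProduct.rid ℂ H ∘ (LinearMap.mul' ℂ ℂ ∘ₗ
    TensorProduct.map ω τ).lTensor H)
    (sum_tmul_tmul_eq (ℛ ℂ h) (fun i ↦ ℛ ℂ ((ℛ ℂ h).left i)) (fun i ↦ ℛ ℂ ((ℛ ℂ h).right i)))
  simp only [Function.comp_apply, map_sum, LinearMap.lTensor_tmul, LinearMap.comp_apply,
    TensorProduct.map_tmul, LinearMap.mul'_apply, TensorProduct.rid_tmul] at key
  rw [convRight_comulHom τ h (ℛ ℂ h), convRight_comulHom _ h (ℛ ℂ h), map_sum]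
  simp only [map_smul, convRight_comulHom _ _ (ℛ ℂ ((ℛ ℂ h).left _)), LinearMap.comp_apply,
    convRight_comulOpHom _ _ (ℛ ℂ ((ℛ ℂ h).right _)), map_sum, Finset.smul_sum, Finset.sum_smul,
    smul_smul, smul_eq_mul]
  rw [← key]
  simp only [mul_comm]

theorem convRight_conv_op (ω τ : H →ₗ[ℂ] ℂ) (h : H) :
    convRight (comulOpHom H) ω (convRight (comulOpHom H) τ h) =
      convRight (comulOpHom H) (τ ∘ₗ convRight (comulHom H) ω) h := by
  have key := congrArg (TensorProduct.lid ℂ H ∘ (LinearMap.mul' ℂ ℂ ∘ₗ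
    TensorProduct.map τ ω).rTensor H ∘ (TensorProduct.assoc ℂ H H H).symm)
    (sum_tmul_tmul_eq (ℛ ℂ h) (fun i ↦ ℛ ℂ ((ℛ ℂ h).left i)) (fun i ↦ ℛ ℂ ((ℛ ℂ h).right i)))
  simp only [Function.comp_apply, map_sum, LinearMap.rTensor_tmul, LinearMap.comp_apply,
    TensorProduct.assoc_symm_tmul,
    TensorProduct.map_tmul, LinearMap.mul'_apply, TensorProduct.lid_tmul] at key
  rw [convRight_comulOpHom τ h (ℛ ℂ h), convRight_comulOpHom _ h (ℛ ℂ h), map_sum]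
  simp only [map_smul, convRight_comulOpHom _ _ (ℛ ℂ ((ℛ ℂ h).right _)), LinearMap.comp_apply,
    convRight_comulHom _ _ (ℛ ℂ ((ℛ ℂ h).left _)), map_sum, Finset.smul_sum, Finset.sum_smul,
    smul_smul, smul_eq_mul]
  rw [← key]
  simp only [mul_comm]

/-- The map `x ⊗ y ↦ x S(y₁) ⊗ y₂`. -/
noncomputable def cancelMap : H ⊗[ℂ] H →ₗ[ℂ] H ⊗[ℂ] H :=
  (LinearMap.mul' ℂ H).rTensor H ∘ₗ (TensorProduct.assoc ℂ H H H).symm.toLinearMap ∘ₗ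
    (CStarHopfAlgebra.antipode.rTensor H ∘ₗ comul).lTensor H

theorem cancelMap_apply (u c : H) : cancelMap ((u ⊗ₜ 1) * comulHom H c) = u ⊗ₜ[ℂ] c := by
  have key := congrArg ((LinearMap.mulLeft ℂ u ∘ₗ LinearMap.mul' ℂ H ∘ₗ
      CStarHopfAlgebra.antipode.lTensor H).rTensor H ∘ₗ
        (TensorProduct.assoc ℂ H H H).symm.toLinearMap)
      (sum_tmul_tmul_eq (ℛ ℂ c) (fun i ↦ ℛ ℂ ((ℛ ℂ c).left i)) (fun i ↦ ℛ ℂ ((ℛ ℂ c).right i)))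
  simp only [map_sum, LinearMap.comp_apply, LinearEquiv.coe_coe, TensorProduct.assoc_symm_tmul,
      LinearMap.rTensor_tmul, LinearMap.lTensor_tmul, LinearMap.mul'_apply,
      LinearMap.mulLeft_apply] at key
  rw [comulHom_apply c (ℛ ℂ c), Finset.mul_sum, map_sum]
  simp only [cancelMap, Algebra.TensorProduct.tmul_mul_tmul, one_mul, LinearMap.comp_apply,
    LinearMap.lTensor_tmul, ← (ℛ ℂ ((ℛ ℂ c).right _)).eq, map_sum, LinearMap.rTensor_tmul,
    TensorProduct.tmul_sum, LinearEquiv.coe_coe, TensorProduct.assoc_symm_tmul,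
    LinearMap.mul'_apply, mul_assoc]
  rw [← key]
  simp only [← TensorProduct.sum_tmul, ← Finset.mul_sum]
  have h2 : ∀ x : H, ∑ i ∈ (ℛ ℂ x).index, (ℛ ℂ x).left i *
      CStarHopfAlgebra.antipode ((ℛ ℂ x).right i) = counit (R := ℂ) x • (1 : H) :=
    fun x ↦ HopfAlgebra.sum_mul_antipode_eq_smul (ℛ ℂ x)
  simp only [h2, mul_smul_comm, mul_one, TensorProduct.smul_tmul, ← TensorProduct.tmul_sum,
    sum_counit_smul]

/-- The inverse of the antipode. -/
noncomputable def antipodeInv : H →ₗ[ℂ] H where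
  toFun h := star (CStarHopfAlgebra.antipode (star h))
  map_add' _ _ := by simp
  map_smul' _ _ := by simp

theorem mul_antipodeInv (x : H) : ∑ i ∈ (ℛ ℂ x).index, (ℛ ℂ x).right i *
    antipodeInv ((ℛ ℂ x).left i) = counit (R := ℂ) x • (1 : H) := by
  have := congrArg star (HopfAlgebra.sum_antipode_mul_eq_smul (reprStar x))
  rw [star_sum, star_smul, star_one, CStarHopfAlgebra.counit_star, ← starRingEnd_apply,
    Complex.conj_conj] at this
  rw [← this]
  refine Finset.sum_congr rfl fun i _ ↦ ?_
  rw [star_mul]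
  change _ = star (star _) * _
  rw [star_star]
  rfl

/-- The map `x ⊗ y ↦ x S⁻¹(y₂) ⊗ y₁`. -/
noncomputable def cancelMapOp : H ⊗[ℂ] H →ₗ[ℂ] H ⊗[ℂ] H :=
  (LinearMap.mul' ℂ H).rTensor H ∘ₗ (TensorProduct.assoc ℂ H H H).symm.toLinearMap ∘ₗ
    (antipodeInv.rTensor H ∘ₗ (comulOpHom H).toLinearMap).lTensor H

theorem cancelMapOp_apply (u c : H) : cancelMapOp ((u ⊗ₜ 1) * comulOpHom H c) = u ⊗ₜ[ℂ] c := by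
  have key := congrArg ((LinearMap.mulLeft ℂ u ∘ₗ LinearMap.mul' ℂ H ∘ₗ
      antipodeInv.lTensor H ∘ₗ (TensorProduct.comm ℂ H H).toLinearMap).rTensor H ∘ₗ
        (TensorProduct.comm ℂ H (H ⊗[ℂ] H)).toLinearMap)
      (sum_tmul_tmul_eq (ℛ ℂ c) (fun i ↦ ℛ ℂ ((ℛ ℂ c).left i)) (fun i ↦ ℛ ℂ ((ℛ ℂ c).right i)))
  simp only [map_sum, LinearMap.comp_apply, LinearEquiv.coe_coe, TensorProduct.comm_tmul,
      LinearMap.rTensor_tmul, LinearMap.lTensor_tmul, LinearMap.mul'_apply,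
      LinearMap.mulLeft_apply] at key
  rw [comulOpHom_apply c (ℛ ℂ c), Finset.mul_sum, map_sum]
  simp only [cancelMapOp, Algebra.TensorProduct.tmul_mul_tmul, one_mul, LinearMap.comp_apply,
    LinearMap.lTensor_tmul, AlgHom.toLinearMap_apply,
    comulOpHom_apply _ (ℛ ℂ ((ℛ ℂ c).left _)), map_sum, LinearMap.rTensor_tmul,
    TensorProduct.tmul_sum, LinearEquiv.coe_coe, TensorProduct.assoc_symm_tmul,
    LinearMap.mul'_apply, mul_assoc]
  rw [key]
  simp only [← TensorProduct.sum_tmul, ← Finset.mul_sum, mul_antipodeInv]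
  simp only [mul_smul_comm, mul_one, TensorProduct.smul_tmul, ← TensorProduct.tmul_sum]
  congr 1
  have h3 := congrArg (TensorProduct.rid ℂ H) (sum_tmul_counit_eq (ℛ ℂ c))
  simpa only [map_sum, TensorProduct.rid_tmul, one_smul] using h3

/-- `τ ∈ H⁰` is the distinguished projection of `H⁰`, that is, the Haar trace on `H`:
`φ τ = τ φ = ε⁰(φ) τ` for all `φ ∈ H⁰`, and `ε⁰(τ) = τ(1) = 1`. -/
def IsHaar (τ : DualHopf H) : Prop :=
  DualHopf.counit τ = 1 ∧
    ∀ φ : DualHopf H, φ * τ = DualHopf.counit φ • τ ∧ τ * φ = DualHopf.counit φ • τ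

theorem IsHaar.unique {τ τ' : DualHopf H} (h : IsHaar τ) (h' : IsHaar τ') : τ = τ' := by
  have h1 := (h.2 τ').1
  rw [(h'.2 τ).2, h.1, h'.1, one_smul, one_smul] at h1
  exact h1.symm

variable (H) in
theorem exists_isHaar [FiniteDimensional ℂ H] : ∃ τ : DualHopf H, IsHaar τ := by
  have : Nontrivial H := ⟨1, 0, fun h ↦ by
    have := congrArg (counit (R := ℂ)) h
    rw [CStarHopfAlgebra.counit_one, map_zero] at this
    exact one_ne_zero this⟩
  obtain ⟨ω, h1, hs, hp⟩ := exists_faithful_functional (H := H)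
  obtain ⟨τ, ht1, ht⟩ := exists_invariant ω h1 hs hp (comulOpHom H) comulOpHom_star
  obtain ⟨σ, hs1, hs'⟩ := exists_invariant ω h1 hs hp (comulHom H) comulHom_star
  have hτ : ∀ h, convRight (comulHom H) τ h = τ h • 1 := by
    intro h
    obtain ⟨c, hc⟩ := fixed_scalar ω h1 hs hp (comulHom H) comulHom_star cancelMap cancelMap_apply
      (convRight (comulHom H) τ h) (by
        rw [convRight_conv]
        congr 1
        congr 1
        exact LinearMap.ext ht)
    have h3 := congrArg (counit (R := ℂ)) hc
    rw [convRight_comulHom τ h (ℛ ℂ h), map_sum, map_smul, CStarHopfAlgebra.counit_one, smul_eq_mul,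
      mul_one] at h3
    rw [hc, ← h3]
    congr 1
    have h4 := congrArg τ (sum_counit_smul (ℛ ℂ h))
    simp only [map_sum, map_smul, smul_eq_mul] at h4 ⊢
    rw [← h4]
    simp only [mul_comm]
  have hσ : ∀ h, convRight (comulOpHom H) σ h = σ h • 1 := by
    intro h
    obtain ⟨c, hc⟩ := fixed_scalar ω h1 hs hp (comulOpHom H) comulOpHom_star cancelMapOp cancelMapOp_apply
      (convRight (comulOpHom H) σ h) (by
        rw [convRight_conv_op]
        congr 1
        congr 1
        exact LinearMap.ext hs')
    have h3 := congrArg (counit (R := ℂ)) hc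
    rw [convRight_comulOpHom σ h (ℛ ℂ h), map_sum, map_smul, CStarHopfAlgebra.counit_one, smul_eq_mul,
      mul_one] at h3
    rw [hc, ← h3]
    congr 1
    have h4 := congrArg (σ ∘ TensorProduct.rid ℂ H) (sum_tmul_counit_eq (ℛ ℂ h))
    simp only [Function.comp_apply, map_sum, TensorProduct.rid_tmul, map_smul, smul_eq_mul,
      one_mul] at h4 ⊢
    rw [← h4]
    simp only [mul_comm]
  have hl : ∀ φ : DualHopf H, φ * ((DualHopf.toDual H).symm τ) =
      DualHopf.counit φ • (DualHopf.toDual H).symm τ := by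
    intro φ
    refine DualHopf.ext fun h ↦ ?_
    have h5 := congrArg φ (hτ h)
    rw [convRight_comulHom τ h (ℛ ℂ h), map_sum, map_smul] at h5
    rw [DualHopf.mul_apply _ _ _ (ℛ ℂ h), DualHopf.smul_apply]
    simp only [map_smul, smul_eq_mul] at h5
    rw [mul_comm]
    refine Eq.trans (Finset.sum_congr rfl fun i _ ↦ ?_) h5
    exact mul_comm _ _
  have hr : ∀ φ : DualHopf H, ((DualHopf.toDual H).symm σ) * φ =
      DualHopf.counit φ • (DualHopf.toDual H).symm σ := by
    intro φ
    refine DualHopf.ext fun h ↦ ?_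
    have h5 := congrArg φ (hσ h)
    rw [convRight_comulOpHom σ h (ℛ ℂ h), map_sum, map_smul] at h5
    rw [DualHopf.mul_apply _ _ _ (ℛ ℂ h), DualHopf.smul_apply]
    simp only [map_smul, smul_eq_mul] at h5
    rw [mul_comm]
    exact h5
  have e : (DualHopf.toDual H).symm τ = (DualHopf.toDual H).symm σ := by
    have h1 := hl ((DualHopf.toDual H).symm σ)
    rw [hr, show DualHopf.counit ((DualHopf.toDual H).symm τ) = 1 from ht1,
      show DualHopf.counit ((DualHopf.toDual H).symm σ) = 1 from hs1, one_smul, one_smul] at h1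
    exact h1.symm
  exact ⟨(DualHopf.toDual H).symm τ, ht1, fun φ ↦ ⟨hl φ, by rw [e]; exact hr φ⟩⟩

variable (H) in
/-- The distinguished projection `τ` of `H⁰`, which is the Haar trace on `H`. It exists by
`exists_isHaar` and is unique by `IsHaar.unique`. -/
noncomputable def haar [FiniteDimensional ℂ H] : DualHopf H := (exists_isHaar H).choose

variable (H) in
theorem isHaar_haar [FiniteDimensional ℂ H] : IsHaar (haar H) := (exists_isHaar H).choose_spec

end Haar

/-! ### Coactions -/

section Slice

variable {H A : Type*} [CStarAlgebra H] [CStarHopfAlgebra H] [NonUnitalCStarAlgebra A]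

/-- The slice map `id ⊗ h : A ⊗ H⁰ → A`, for `h ∈ H`; this is `x ↦ x̂(h)`. -/
noncomputable def slice (h : H) : A ⊗[ℂ] DualHopf H →ₗ[ℂ] A :=
  (TensorProduct.rid ℂ A).toLinearMap ∘ₗ
    LinearMap.lTensor A (DualHopf.eval h)

variable (A H) in
/-- The topology of the C*-algebra `A ⊗ H⁰`. As `H⁰` is finite dimensional, `A ⊗ H⁰` is a finite
power of `A`, and a net converges in it if and only if all its slices converge in norm. -/
@[reducible] noncomputable def sliceTopology : TopologicalSpace (A ⊗[ℂ] DualHopf H) :=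
  TopologicalSpace.induced (fun x (h : H) ↦ slice h x) inferInstance

theorem slice_tmul (h : H) (a : A) (φ : DualHopf H) : slice h (a ⊗ₜ[ℂ] φ) = φ h • a := by
  simp [slice]; rfl

theorem slice_mul_tmul (h : H) (x y : A ⊗[ℂ] DualHopf H) {ι : Type*} (r : Repr ℂ h ι) :
    slice h (x * y) = ∑ i ∈ r.index, slice (r.left i) x * slice (r.right i) y := by
  induction x with
  | zero => simp
  | add x x' hx hx' => simp [add_mul, hx, hx', Finset.sum_add_distrib]
  | tmul a φ =>
    induction y with
    | zero => simp
    | add x x' hx hx' => simp [mul_add, hx, hx', Finset.sum_add_distrib]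
    | tmul b ψ =>
      simp only [Algebra.TensorProduct.tmul_mul_tmul, slice_tmul]
      have : (φ * ψ) h = ∑ i ∈ r.index, φ (r.left i) * ψ (r.right i) :=
        DualHopf.mul_apply φ ψ h r
      rw [this, Finset.sum_smul]
      refine Finset.sum_congr rfl fun i _ ↦ ?_
      rw [smul_mul_smul_comm]

theorem slice_star (h : H) (x : A ⊗[ℂ] DualHopf H) :
    slice h (star x) = star (slice (star (CStarHopfAlgebra.antipode h)) x) := by
  induction x with
  | zero => simp
  | add x x' hx hx' => simp [hx, hx']
  | tmul a φ =>
    simp only [TensorProduct.star_tmul, slice_tmul, star_smul]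
    rfl

theorem slice_add_left (h k : H) (x : A ⊗[ℂ] DualHopf H) :
    slice (h + k) x = slice h x + slice k x := by
  induction x with
  | zero => simp
  | add x x' hx hx' => simp only [map_add, hx, hx']; abel
  | tmul a φ => simp [slice_tmul, add_smul]

theorem slice_smul_left (c : ℂ) (h : H) (x : A ⊗[ℂ] DualHopf H) :
    slice (c • h) x = c • slice h x := by
  induction x with
  | zero => simp
  | add x x' hx hx' => simp only [map_add, hx, hx', smul_add]
  | tmul a φ => simp [slice_tmul, mul_smul]

end Slice

/-- The conditions on a `*`-homomorphism `ρ : A → A ⊗ H⁰` to be a coaction of `H⁰` on `A`: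
the closed linear span of `ρ(A)(A ⊗ H⁰)` is `A ⊗ H⁰`, `(id ⊗ ε⁰) ∘ ρ = id`, and
`(ρ ⊗ id) ∘ ρ = (id ⊗ Δ⁰) ∘ ρ`. -/
def IsCoaction {H A : Type*} [CStarAlgebra H] [CStarHopfAlgebra H] [FiniteDimensional ℂ H]
    [NonUnitalCStarAlgebra A] (ρ : A →⋆ₙₐ[ℂ] A ⊗[ℂ] DualHopf H) : Prop :=
  @closure _ (sliceTopology H A)
    (Submodule.span ℂ {y | ∃ (a : A) (x : A ⊗[ℂ] DualHopf H), y = ρ a * x} :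
      Set (A ⊗[ℂ] DualHopf H)) = Set.univ ∧
  (∀ a : A, TensorProduct.rid ℂ A (DualHopf.counit.lTensor A (ρ a)) = a) ∧
  ∀ a : A, TensorProduct.assoc ℂ A (DualHopf H) (DualHopf H)
      (LinearMap.rTensor (DualHopf H) (ρ : A →ₗ[ℂ] A ⊗[ℂ] DualHopf H) (ρ a)) =
    DualHopf.comul.lTensor A (ρ a)

/-- A coaction of `H⁰` on a (possibly non-unital) C*-algebra `A`. -/
structure Coaction (H A : Type*) [CStarAlgebra H] [CStarHopfAlgebra H] [FiniteDimensional ℂ H]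
    [NonUnitalCStarAlgebra A] where
  /-- The `*`-homomorphism `ρ : A → A ⊗ H⁰`. -/
  hom : A →⋆ₙₐ[ℂ] A ⊗[ℂ] DualHopf H
  isCoaction : IsCoaction hom

/-- Left multiplication by `a` on the first leg of `A ⊗ H`. -/
noncomputable def leftA {A H : Type*} [CStarAlgebra H] [NonUnitalCStarAlgebra A] :
    A →ₗ[ℂ] Module.End ℂ (A ⊗[ℂ] H) :=
  LinearMap.rTensorHom H ∘ₗ LinearMap.mul ℂ A

theorem leftA_tmul {A H : Type*} [CStarAlgebra H] [NonUnitalCStarAlgebra A] (a b : A) (k : H) :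
    leftA a (b ⊗ₜ[ℂ] k) = (a * b) ⊗ₜ[ℂ] k := rfl

theorem leftA_mul {A H : Type*} [CStarAlgebra H] [NonUnitalCStarAlgebra A] (a b : A) :
    leftA (H := H) (a * b) = leftA a * leftA b := by
  ext c k; simp [leftA_tmul, mul_assoc]

namespace Coaction
variable {H A : Type*} [CStarAlgebra H] [CStarHopfAlgebra H] [FiniteDimensional ℂ H]
    [NonUnitalCStarAlgebra A] (ρ : Coaction H A)


/-- The action of `H` on `A` induced by `ρ`: `h · a = (id ⊗ h)(ρ(a))`. -/
noncomputable def act : H →ₗ[ℂ] A →ₗ[ℂ] A where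
  toFun h := slice h ∘ₗ (ρ.hom : A →ₗ[ℂ] A ⊗[ℂ] DualHopf H)
  map_add' h k := LinearMap.ext fun a ↦ slice_add_left h k (ρ.hom a)
  map_smul' c h := LinearMap.ext fun a ↦ slice_smul_left c h (ρ.hom a)

theorem act_apply (h : H) (a : A) : ρ.act h a = slice h (ρ.hom a) := rfl

theorem act_mul (h : H) (a b : A) {ι : Type*} (r : Repr ℂ h ι) :
    ρ.act h (a * b) = ∑ i ∈ r.index, ρ.act (r.left i) a * ρ.act (r.right i) b := by
  simpa [act_apply] using slice_mul_tmul h (ρ.hom a) (ρ.hom b) r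

theorem act_star (h : H) (a : A) :
    ρ.act h (star a) = star (ρ.act (star (CStarHopfAlgebra.antipode h)) a) := by
  rw [act_apply, map_star, slice_star]; rfl

theorem act_one (a : A) : ρ.act 1 a = a := ρ.isCoaction.2.1 a

theorem slice_slice (h k : H) (x : A ⊗[ℂ] DualHopf H) :
   ρ.act h (slice k x) =
     slice h (TensorProduct.rid ℂ _ (LinearMap.lTensor (A ⊗[ℂ] DualHopf H) (DualHopf.eval k) (LinearMap.rTensor (DualHopf H) (ρ.hom : A →ₗ[ℂ] A ⊗[ℂ] DualHopf H) x))) := by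
  induction x with
  | zero => simp
  | add x x' hx hx' => simp [hx, hx']
  | tmul a φ =>
    simp [slice_tmul, act_apply, DualHopf.eval_apply]

theorem slice_mul_comul (h k : H) (x : A ⊗[ℂ] DualHopf H) :
    slice h (TensorProduct.rid ℂ _ (LinearMap.lTensor (A ⊗[ℂ] DualHopf H) (DualHopf.eval k)
      ((TensorProduct.assoc ℂ A (DualHopf H) (DualHopf H)).symm (DualHopf.comul.lTensor A x)))) =
      slice (h * k) x := by
  have key : ∀ (a : A) (z : DualHopf H ⊗[ℂ] DualHopf H),
      slice h (TensorProduct.rid ℂ _ (LinearMap.lTensor (A ⊗[ℂ] DualHopf H) (DualHopf.eval k)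
        ((TensorProduct.assoc ℂ A (DualHopf H) (DualHopf H)).symm (a ⊗ₜ z)))) =
        TensorProduct.lid ℂ ℂ (TensorProduct.map (DualHopf.eval h) (DualHopf.eval k) z) • a := by
    intro a z
    induction z with
    | zero => simp
    | add x y hx hy => simp only [TensorProduct.tmul_add, map_add, hx, hy, add_smul]
    | tmul f g => simp [slice_tmul, DualHopf.eval_apply, smul_smul, mul_comm]
  induction x with
  | zero => simp
  | add x x' hx hx' => simp only [map_add, hx, hx']
  | tmul a φ =>
    rw [LinearMap.lTensor_tmul, key, DualHopf.eval_eval_comul, slice_tmul]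

theorem act_act (h k : H) (a : A) : ρ.act h (ρ.act k a) = ρ.act (h * k) a := by
  change ρ.act h (slice k (ρ.hom a)) = _
  rw [slice_slice, ← LinearEquiv.symm_apply_eq _ |>.mpr (ρ.isCoaction.2.2 a).symm, slice_mul_comul]
  rfl


/-- The action of `H` on `A` as a homomorphism of algebras. -/
noncomputable def actHom : H →ₐ[ℂ] Module.End ℂ A :=
  AlgHom.ofLinearMap ρ.act (LinearMap.ext ρ.act_one)
    (fun h k ↦ LinearMap.ext fun a ↦ (ρ.act_act h k a).symm)

/-! ### The crossed product -/

/-- The action of `H` on `A ⊗ H` given by `h (b ⊗ k) = (h₁ · b) ⊗ h₂ k`. -/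
noncomputable def leftH : H →ₐ[ℂ] Module.End ℂ (A ⊗[ℂ] H) :=
  (Module.endTensorEndAlgHom (R := ℂ) (S := ℂ) (A := ℂ) (M := A) (N := H)).comp
    ((Algebra.TensorProduct.map ρ.actHom (Algebra.lmul ℂ H)).comp (Bialgebra.comulAlgHom ℂ H))

theorem leftH_tmul (h : H) (b : A) (k : H) {ι : Type*} (r : Repr ℂ h ι) :
    ρ.leftH h (b ⊗ₜ[ℂ] k) = ∑ i ∈ r.index, ρ.act (r.left i) b ⊗ₜ[ℂ] (r.right i * k) := by
  simp [leftH, ← r.eq, Module.endTensorEndAlgHom_apply]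
  rfl


theorem leftH_leftA (h : H) (a : A) (y : A ⊗[ℂ] H) {ι : Type*} (r : Repr ℂ h ι) :
    ρ.leftH h (leftA a y) =
      ∑ i ∈ r.index, leftA (ρ.act (r.left i) a) (ρ.leftH (r.right i) y) := by
  induction y with
  | zero => simp
  | add x y hx hy => simp only [map_add, hx, hy, Finset.sum_add_distrib]
  | tmul b k =>
    have := congrArg (TensorProduct.map (LinearMap.mul' ℂ A ∘ₗ
      TensorProduct.map (ρ.act.flip a) (ρ.act.flip b)) (LinearMap.mulRight ℂ k) ∘ₗ
        (TensorProduct.assoc ℂ H H H).symm.toLinearMap)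
      (sum_tmul_tmul_eq r (fun i ↦ ℛ ℂ (r.left i)) (fun i ↦ ℛ ℂ (r.right i)))
    simp only [map_sum, LinearMap.comp_apply, LinearEquiv.coe_coe, TensorProduct.assoc_symm_tmul,
      TensorProduct.map_tmul, LinearMap.mul'_apply, LinearMap.flip_apply,
      LinearMap.mulRight_apply] at this
    rw [leftA_tmul, leftH_tmul _ _ _ _ r]
    simp only [ρ.act_mul _ a b (ℛ ℂ (r.left _)), TensorProduct.sum_tmul]
    rw [this]
    refine Finset.sum_congr rfl fun i _ ↦ ?_
    rw [leftH_tmul _ _ _ _ (ℛ ℂ (r.right i)), map_sum]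
    rfl

theorem star_act (h : H) (a : A) :
    star (ρ.act h a) = ρ.act (star (CStarHopfAlgebra.antipode h)) (star a) := by
  rw [act_star]
  have := CStarHopfAlgebra.antipode_star (star h)
  rw [star_star] at this
  rw [this, star_star]


/-- The product of the crossed product: `(a ⊗ h)(b ⊗ k) = a (h₁ · b) ⊗ h₂ k`. -/
noncomputable def mulMap : A ⊗[ℂ] H →ₗ[ℂ] Module.End ℂ (A ⊗[ℂ] H) :=
  TensorProduct.lift ((LinearMap.mul ℂ (Module.End ℂ (A ⊗[ℂ] H))).compl₁₂ leftA
    ρ.leftH.toLinearMap)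

theorem mulMap_tmul (a : A) (h : H) (y : A ⊗[ℂ] H) :
    ρ.mulMap (a ⊗ₜ h) y = leftA a (ρ.leftH h y) := rfl

theorem mulMap_leftA (a : A) (x y : A ⊗[ℂ] H) :
    ρ.mulMap (leftA a x) y = leftA a (ρ.mulMap x y) := by
  induction x with
  | zero => simp
  | add x x' hx hx' => simp only [map_add, LinearMap.add_apply, hx, hx']
  | tmul b k => simp only [leftA_tmul, mulMap_tmul, leftA_mul, Module.End.mul_apply]

theorem mulMap_leftH (h : H) (x y : A ⊗[ℂ] H) :
    ρ.mulMap (ρ.leftH h x) y = ρ.leftH h (ρ.mulMap x y) := by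
  induction x with
  | zero => simp
  | add x x' hx hx' => simp only [map_add, LinearMap.add_apply, hx, hx']
  | tmul b k =>
    rw [ρ.leftH_tmul _ _ _ (ℛ ℂ h), map_sum, LinearMap.sum_apply, mulMap_tmul,
      ρ.leftH_leftA _ _ _ (ℛ ℂ h)]
    simp only [mulMap_tmul, map_mul, Module.End.mul_apply]

theorem mulMap_assoc (x y z : A ⊗[ℂ] H) :
    ρ.mulMap (ρ.mulMap x y) z = ρ.mulMap x (ρ.mulMap y z) := by
  induction x with
  | zero => simp
  | add x x' hx hx' => simp only [map_add, LinearMap.add_apply, hx, hx']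
  | tmul b k => rw [mulMap_tmul, mulMap_tmul, mulMap_leftA, mulMap_leftH]

theorem mulMap_mulRight (h : H) (x y : A ⊗[ℂ] H) :
    ρ.mulMap ((LinearMap.mulRight ℂ h).lTensor A x) y = ρ.mulMap x (ρ.leftH h y) := by
  induction x with
  | zero => simp
  | add x x' hx hx' => simp only [map_add, LinearMap.add_apply, hx, hx']
  | tmul b k =>
    simp only [LinearMap.lTensor_tmul, LinearMap.mulRight_apply, mulMap_tmul, map_mul,
      Module.End.mul_apply]

/-- The linear map `a ⊗ h ↦ (h₁ · a) ⊗ h₂`. -/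
noncomputable def starMap : A ⊗[ℂ] H →ₗ[ℂ] A ⊗[ℂ] H :=
  TensorProduct.lift (ρ.leftH.toLinearMap.flip ∘ₗ (TensorProduct.mk ℂ A H).flip 1)

theorem starMap_tmul (a : A) (h : H) : ρ.starMap (a ⊗ₜ h) = ρ.leftH h (a ⊗ₜ 1) := rfl

theorem antipode_aux (h : H) :
    ∑ i ∈ (ℛ ℂ h).index, ∑ j ∈ (ℛ ℂ ((ℛ ℂ h).right i)).index,
      (CStarHopfAlgebra.antipode ((ℛ ℂ h).left i) * (ℛ ℂ ((ℛ ℂ h).right i)).left j) ⊗ₜ[ℂ]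
        (ℛ ℂ ((ℛ ℂ h).right i)).right j = (1 : H) ⊗ₜ[ℂ] h := by
  have := congrArg ((LinearMap.mul' ℂ H ∘ₗ CStarHopfAlgebra.antipode.rTensor H).rTensor H ∘ₗ
        (TensorProduct.assoc ℂ H H H).symm.toLinearMap)
      (sum_tmul_tmul_eq (ℛ ℂ h) (fun i ↦ ℛ ℂ ((ℛ ℂ h).left i)) (fun i ↦ ℛ ℂ ((ℛ ℂ h).right i)))
  simp only [map_sum, LinearMap.comp_apply, LinearEquiv.coe_coe, TensorProduct.assoc_symm_tmul,
      LinearMap.rTensor_tmul, LinearMap.mul'_apply] at this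
  rw [← this]
  simp only [← TensorProduct.sum_tmul]
  have h2 : ∀ x : H, ∑ i ∈ (ℛ ℂ x).index, CStarHopfAlgebra.antipode ((ℛ ℂ x).left i) *
      (ℛ ℂ x).right i = counit (R := ℂ) x • (1 : H) :=
    fun x ↦ HopfAlgebra.sum_antipode_mul_eq_smul (ℛ ℂ x)
  simp only [h2, TensorProduct.smul_tmul, ← TensorProduct.tmul_sum, sum_counit_smul]

/-- The involution of the crossed product: `(a ⊗ h)* = (h₁* · a*) ⊗ h₂*`. -/
noncomputable def cstar (x : A ⊗[ℂ] H) : A ⊗[ℂ] H := ρ.starMap (star x)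

theorem cstar_add (x y : A ⊗[ℂ] H) : ρ.cstar (x + y) = ρ.cstar x + ρ.cstar y := by
  simp [cstar]

theorem cstar_zero : ρ.cstar 0 = 0 := by simp [cstar]

theorem cstar_smul (c : ℂ) (x : A ⊗[ℂ] H) : ρ.cstar (c • x) = star c • ρ.cstar x := by
  simp [cstar]

theorem cstar_tmul (a : A) (h : H) : ρ.cstar (a ⊗ₜ h) = ρ.leftH (star h) (star a ⊗ₜ 1) := rfl

theorem leftH_mulRight (h k : H) (x : A ⊗[ℂ] H) :
    ρ.leftH h ((LinearMap.mulRight ℂ k).lTensor A x) =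
      (LinearMap.mulRight ℂ k).lTensor A (ρ.leftH h x) := by
  induction x with
  | zero => simp
  | add x x' hx hx' => simp only [map_add, hx, hx']
  | tmul b l =>
    rw [ρ.leftH_tmul _ _ _ (ℛ ℂ h), map_sum, LinearMap.lTensor_tmul, LinearMap.mulRight_apply,
      ρ.leftH_tmul _ _ _ (ℛ ℂ h)]
    simp only [LinearMap.lTensor_tmul, LinearMap.mulRight_apply, mul_assoc]

theorem cstar_sum {ι : Type*} (s : Finset ι) (f : ι → A ⊗[ℂ] H) :
    ρ.cstar (∑ i ∈ s, f i) = ∑ i ∈ s, ρ.cstar (f i) :=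
  map_sum (AddMonoidHom.mk' ρ.cstar ρ.cstar_add) f s

theorem cstar_leftH (h : H) (y : A ⊗[ℂ] H) :
    ρ.cstar (ρ.leftH h y) = (LinearMap.mulRight ℂ (star h)).lTensor A (ρ.cstar y) := by
  induction y with
  | zero => simp [cstar_zero]
  | add x x' hx hx' => simp only [map_add, cstar_add, hx, hx']
  | tmul b k =>
    have key := congrArg (fun z ↦ TensorProduct.map (ρ.act.flip (star b)) LinearMap.id (star z))
      (antipode_aux h)
    simp only [star_sum, map_sum, TensorProduct.star_tmul, star_one, TensorProduct.map_tmul,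
      LinearMap.flip_apply, LinearMap.id_apply, act_one] at key
    rw [ρ.leftH_tmul _ _ _ (ℛ ℂ h), cstar_sum, cstar_tmul, ← leftH_mulRight]
    simp only [cstar_tmul, star_mul, map_mul, Module.End.mul_apply]
    rw [← map_sum, LinearMap.lTensor_tmul, LinearMap.mulRight_apply, one_mul, ← key]
    congr 1
    refine Finset.sum_congr rfl fun i _ ↦ ?_
    rw [ρ.leftH_tmul _ _ _ (reprStar _)]
    refine Finset.sum_congr rfl fun j _ ↦ ?_
    rw [star_act, act_act, mul_one, star_mul]
    rfl

theorem cstar_leftA (a : A) (y : A ⊗[ℂ] H) :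
    ρ.cstar (leftA a y) = ρ.mulMap (ρ.cstar y) (star a ⊗ₜ 1) := by
  induction y with
  | zero => simp [cstar_zero]
  | add x x' hx hx' => simp only [map_add, LinearMap.add_apply, cstar_add, hx, hx']
  | tmul b k =>
    rw [leftA_tmul, cstar_tmul, cstar_tmul, mulMap_leftH, mulMap_tmul, map_one,
      Module.End.one_apply, leftA_tmul, star_mul]

theorem cstar_mul (x y : A ⊗[ℂ] H) :
    ρ.cstar (ρ.mulMap x y) = ρ.mulMap (ρ.cstar y) (ρ.cstar x) := by
  induction x with
  | zero => simp [cstar_zero]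
  | add x x' hx hx' => simp only [map_add, LinearMap.add_apply, cstar_add, hx, hx']
  | tmul a h => rw [mulMap_tmul, cstar_leftA, cstar_leftH, mulMap_mulRight, cstar_tmul]

theorem cstar_cstar (x : A ⊗[ℂ] H) : ρ.cstar (ρ.cstar x) = x := by
  induction x with
  | zero => simp [cstar_zero]
  | add x x' hx hx' => simp only [cstar_add, hx, hx']
  | tmul a h =>
    rw [cstar_tmul, cstar_leftH, cstar_tmul, star_one, map_one]
    simp


/-- The crossed product `A ⋊_ρ H`: the space `A ⊗ H` with `(a ⋊ h)(b ⋊ k) = a (h₁ · b) ⋊ h₂ k` and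
`(a ⋊ h)* = (h₁* · a*) ⋊ h₂*` (see `mk_mul_mk` and `star_mk`). The C*-norm of this `*`-algebra is
determined by the `*`-algebra structure, and the notions used below (multipliers, conditional
expectations) do not refer to it. -/
def CrossedProduct (_ρ : Coaction H A) : Type _ := A ⊗[ℂ] H

namespace CrossedProduct

noncomputable instance : AddCommGroup ρ.CrossedProduct := 
  (inferInstance : AddCommGroup (A ⊗[ℂ] H))
noncomputable instance : Module ℂ ρ.CrossedProduct := 
  (inferInstance : Module ℂ (A ⊗[ℂ] H))

noncomputable instance : NonUnitalRing ρ.CrossedProduct where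
  __ := (inferInstance : AddCommGroup ρ.CrossedProduct)
  mul x y := ρ.mulMap x y
  left_distrib x y z := map_add (ρ.mulMap x) y z
  right_distrib x y z := (congrArg (fun f : Module.End ℂ (A ⊗[ℂ] H) ↦ f z) (map_add ρ.mulMap x y) :)
  zero_mul x := (congrArg (fun f : Module.End ℂ (A ⊗[ℂ] H) ↦ f x) (map_zero ρ.mulMap) :)
  mul_zero x := map_zero (ρ.mulMap x)
  mul_assoc x y z := ρ.mulMap_assoc x y z

instance : IsScalarTower ℂ ρ.CrossedProduct ρ.CrossedProduct :=
  ⟨fun c x y ↦ (congrArg (fun f : Module.End ℂ (A ⊗[ℂ] H) ↦ f y) (map_smul ρ.mulMap c x) :)⟩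

instance : SMulCommClass ℂ ρ.CrossedProduct ρ.CrossedProduct :=
  ⟨fun c x y ↦ (map_smul (ρ.mulMap x) c y).symm⟩

noncomputable instance : StarRing ρ.CrossedProduct where
  star x := ρ.cstar x
  star_involutive x := ρ.cstar_cstar x
  star_add x y := ρ.cstar_add x y
  star_mul x y := ρ.cstar_mul x y

instance : StarModule ℂ ρ.CrossedProduct := ⟨fun c x ↦ ρ.cstar_smul c x⟩

/-- The element `a ⋊ h`. -/
noncomputable def mk (a : A) (h : H) : ρ.CrossedProduct := a ⊗ₜ[ℂ] h

theorem mk_mul_mk (a b : A) (h k : H) {ι : Type*} (r : Repr ℂ h ι) :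
    mk ρ a h * mk ρ b k = ∑ i ∈ r.index, mk ρ (a * ρ.act (r.left i) b) (r.right i * k) :=
  (congrArg (leftA a) (ρ.leftH_tmul h b k r)).trans (map_sum _ _ _)

theorem star_mk (a : A) (h : H) {ι : Type*} (r : Repr ℂ h ι) :
    star (mk ρ a h) =
      ∑ i ∈ r.index, mk ρ (ρ.act (star (r.left i)) (star a)) (star (r.right i)) := by
  let r' : Repr ℂ (star h) ι :=
    { index := r.index
      left := fun i ↦ star (r.left i)
      right := fun i ↦ star (r.right i)
      eq := by rw [CStarHopfAlgebra.comul_star, ← r.eq, star_sum]; rfl }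
  refine (ρ.leftH_tmul (star h) (star a) 1 r').trans ?_
  simp only [mul_one]
  rfl

end CrossedProduct

/-- The inclusion `a ↦ a ⋊ 1` of `A` in `A ⋊_ρ H`. -/
noncomputable def incl : A →⋆ₙₐ[ℂ] ρ.CrossedProduct where
  toFun a := CrossedProduct.mk ρ a 1
  map_smul' _ _ := rfl
  map_zero' := TensorProduct.zero_tmul _ _
  map_add' a b := TensorProduct.add_tmul a b 1
  map_mul' a b := by
    change _ = ρ.mulMap (a ⊗ₜ 1) (b ⊗ₜ 1)
    rw [mulMap_tmul, map_one]; rfl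
  map_star' a := by
    change _ = ρ.cstar (a ⊗ₜ 1)
    rw [cstar_tmul, star_one, map_one]; rfl

/-- The canonical conditional expectation `E₁(a ⋊ h) = τ(h) a` from `A ⋊_ρ H` onto `A`. -/
noncomputable def canonicalExpectation : ρ.CrossedProduct →ₗ[ℂ] A :=
  (TensorProduct.rid ℂ A).toLinearMap ∘ₗ
    LinearMap.lTensor A (DualHopf.toDual H (haar H))

theorem canonicalExpectation_mk (a : A) (h : H) :
    ρ.canonicalExpectation (CrossedProduct.mk ρ a h) = haar H h • a :=
  TensorProduct.rid_tmul (R := ℂ) _ _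

end Coaction

/-! ### Multipliers, conditional expectations, freeness -/

/-- The elements of the multiplier algebra `M(B)`: double centralizers, the pairs `(L, R)` of maps
`B → B` with `R(x) y = x L(y)`. On a C*-algebra such maps are automatically bounded (closed graph
theorem), so that no continuity has to be required. -/
@[ext]
structure Multiplier (B : Type*) [NonUnitalRing B] [Module ℂ B] where
  left : B →ₗ[ℂ] B
  right : B →ₗ[ℂ] B
  central (x y : B) : right x * y = x * left y

namespace Multiplier
variable {B : Type*} [NonUnitalRing B] [Module ℂ B]

/-- The product of `M(B)`. -/
instance : Mul (Multiplier B) where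
  mul S T :=
    { left := S.left ∘ₗ T.left
      right := T.right ∘ₗ S.right
      central := fun x y ↦ by
        rw [LinearMap.comp_apply, T.central, S.central, LinearMap.comp_apply] }

/-- The canonical map `B → M(B)`. -/
def ofElement [IsScalarTower ℂ B B] [SMulCommClass ℂ B B] (b : B) : Multiplier B where
  left := LinearMap.mulLeft ℂ b
  right := LinearMap.mulRight ℂ b
  central x y := mul_assoc x b y

end Multiplier

/-- `F` is a conditional expectation from `B` onto `A`, where `A` is a C*-subalgebra of `B` via `ι`: a
positive linear `A`-bimodule map which restricts to the identity on `A`. (The positive elements of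
a C*-algebra are the elements `c* c`.) -/
structure IsConditionalExpectation {A B : Type*} [NonUnitalCStarAlgebra A] [NonUnitalRing B]
    [StarRing B] [Module ℂ B] (ι : A →⋆ₙₐ[ℂ] B) (F : B →ₗ[ℂ] A) : Prop where
  apply_incl (a : A) : F (ι a) = a
  left_module (a : A) (x : B) : F (ι a * x) = a * F x
  right_module (x : B) (a : A) : F (x * ι a) = F x * a
  positive (x : B) : ∃ c : A, F (star x * x) = star c * c

namespace Coaction
variable {H A : Type*} [CStarAlgebra H] [CStarHopfAlgebra H] [FiniteDimensional ℂ H]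
    [NonUnitalCStarAlgebra A] (ρ : Coaction H A)

theorem multiplierMap_central (m : 𝓜(ℂ, A)) (x y : A ⊗[ℂ] H) :
    ρ.mulMap (ρ.cstar (((star m).fst : A →ₗ[ℂ] A).rTensor H (ρ.cstar x))) y =
      ρ.mulMap x ((m.fst : A →ₗ[ℂ] A).rTensor H y) := by
  suffices h : ∀ x, ρ.mulMap (ρ.cstar (((star m).fst : A →ₗ[ℂ] A).rTensor H x)) y =
      ρ.mulMap (ρ.cstar x) ((m.fst : A →ₗ[ℂ] A).rTensor H y) by
    simpa only [cstar_cstar] using h (ρ.cstar x)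
  intro x
  induction x with
  | zero => simp [cstar_zero]
  | add x x' hx hx' => simp only [map_add, LinearMap.add_apply, cstar_add, hx, hx']
  | tmul b k =>
    rw [LinearMap.rTensor_tmul, cstar_tmul, cstar_tmul, mulMap_leftH, mulMap_leftH, mulMap_tmul,
      mulMap_tmul, map_one]
    congr 1
    induction y with
    | zero => simp
    | add x x' hx hx' => simp only [map_add, hx, hx']
    | tmul c h =>
      simp only [Module.End.one_apply, leftA_tmul, LinearMap.rTensor_tmul]
      congr 1
      have := m.central (star b) c
      rw [ContinuousLinearMap.coe_coe, ContinuousLinearMap.coe_coe, ← this]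
      simp

/-- The right centralizer of the multiplier of `A ⋊_ρ H` induced by `m`: `x ↦ (m* x*)*`. -/
noncomputable def multiplierRight (m : 𝓜(ℂ, A)) : A ⊗[ℂ] H →ₗ[ℂ] A ⊗[ℂ] H where
  toFun x := ρ.cstar (((star m).fst : A →ₗ[ℂ] A).rTensor H (ρ.cstar x))
  map_add' x y := by rw [cstar_add, map_add, cstar_add]
  map_smul' c x := by rw [cstar_smul, map_smul, cstar_smul, star_star]; rfl

/-- The inclusion `M(A) ⊆ M(A ⋊_ρ H)`: the multiplier `m` of `A` acts on `A ⋊_ρ H` from the left by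
`m (a ⋊ h) = (m a) ⋊ h`, and from the right by `x m = (m* x*)*`. It extends the inclusion of `A` in
`A ⋊_ρ H` (`multiplierMap_coe`). -/
noncomputable def multiplierMap (m : 𝓜(ℂ, A)) : Multiplier ρ.CrossedProduct where
  left := (m.fst : A →ₗ[ℂ] A).rTensor H
  right := ρ.multiplierRight m
  central x y := ρ.multiplierMap_central m x y

theorem multiplierMap_coe (a : A) :
    ρ.multiplierMap (a : 𝓜(ℂ, A)) = Multiplier.ofElement (ρ.incl a) := by
  have hl (x : A ⊗[ℂ] H) : leftA a x = ρ.mulMap (a ⊗ₜ 1) x := by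
    rw [mulMap_tmul, map_one]; rfl
  have hr (x : A ⊗[ℂ] H) : ρ.multiplierRight (a : 𝓜(ℂ, A)) x = ρ.mulMap x (a ⊗ₜ 1) := by
    have h1 : ((star (a : 𝓜(ℂ, A))).fst : A →ₗ[ℂ] A) = LinearMap.mulLeft ℂ (star a) := by
      ext b
      simp
    have h2 := ρ.cstar_leftA (star a) (ρ.cstar x)
    rw [star_star, cstar_cstar] at h2
    change ρ.cstar (((star (a : 𝓜(ℂ, A))).fst : A →ₗ[ℂ] A).rTensor H (ρ.cstar x)) = _
    rw [h1, ← h2]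
    rfl
  exact Multiplier.ext (LinearMap.ext hl) (LinearMap.ext hr)

theorem multiplierMap_mul (m n : 𝓜(ℂ, A)) :
    ρ.multiplierMap (m * n) = ρ.multiplierMap m * ρ.multiplierMap n := by
  have hl (x : A ⊗[ℂ] H) : ((m * n).fst : A →ₗ[ℂ] A).rTensor H x =
      (m.fst : A →ₗ[ℂ] A).rTensor H ((n.fst : A →ₗ[ℂ] A).rTensor H x) := by
    rw [← LinearMap.comp_apply, ← LinearMap.rTensor_comp]
    rfl
  have hr (x : A ⊗[ℂ] H) : ρ.multiplierRight (m * n) x =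
      ρ.multiplierRight n (ρ.multiplierRight m x) := by
    change ρ.cstar _ = ρ.cstar (((star n).fst : A →ₗ[ℂ] A).rTensor H (ρ.cstar
      (ρ.cstar (((star m).fst : A →ₗ[ℂ] A).rTensor H (ρ.cstar x)))))
    rw [cstar_cstar, ← LinearMap.comp_apply (LinearMap.rTensor H _), ← LinearMap.rTensor_comp,
      star_mul]
    rfl
  exact Multiplier.ext (LinearMap.ext hl) (LinearMap.ext hr)

theorem multiplierMap_injective : Function.Injective ρ.multiplierMap := by
  intro m n h
  have h1 (a : A) : m.fst a ⊗ₜ[ℂ] (1 : H) = n.fst a ⊗ₜ 1 :=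
    congrArg (fun T : Multiplier ρ.CrossedProduct ↦ T.left (CrossedProduct.mk ρ a 1)) h
  have hfst (a : A) : m.fst a = n.fst a := by
    have h2 := congrArg (TensorProduct.rid ℂ A ∘ (counit (R := ℂ) (A := H)).lTensor A) (h1 a)
    simpa using h2
  have hsnd (a : A) : m.snd a = n.snd a := by
    have h3 : ∀ y, (m.snd a - n.snd a) * y = 0 := fun y ↦ by
      rw [sub_mul, m.central, n.central, hfst, sub_self]
    exact sub_eq_zero.mp (CStarRing.mul_star_self_eq_zero_iff _ |>.mp (h3 _))
  exact DoubleCentralizer.ext ℂ A _ _ (Prod.ext (ContinuousLinearMap.ext hfst)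
    (ContinuousLinearMap.ext hsnd))

/-- `ρ` is free: if `x ∈ M(A) ⊗ H⁰` satisfies `x ρ(a) = (a ⊗ 1⁰) x` for all `a ∈ A`, then
`x ∈ (A' ∩ M(A)) ⊗ ℂ τ`. -/
def IsFree : Prop :=
  ∀ x : 𝓜(ℂ, A) ⊗[ℂ] DualHopf H,
    (∀ a : A,
      x * ((DoubleCentralizer.coeHom : A →⋆ₙₐ[ℂ] 𝓜(ℂ, A)) : A →ₗ[ℂ] 𝓜(ℂ, A)).rTensor
        (DualHopf H) (ρ.hom a) = ((a : 𝓜(ℂ, A)) ⊗ₜ[ℂ] (1 : DualHopf H)) * x) →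
    ∃ m ∈ Set.centralizer (Set.range fun a : A ↦ (a : 𝓜(ℂ, A))), x = m ⊗ₜ[ℂ] haar H

end Coaction

end CStarCoaction

open CStarCoaction

/-! Write B for A ⋊ H, E for the canonical expectation and τ for the Haar trace. The implications
run 1 → 3 → 2 → 1.

Two facts about τ carry the argument. It is the normalized trace of the regular representation
(`haar_apply`), hence positive and faithful. For a τ-orthonormal basis kᵢ of H, every x in B has the
form ∑ᵢ (1 ⋊ kᵢ)(bᵢ ⋊ 1), and E(x* x) = ∑ᵢ bᵢ* bᵢ. So E is a faithful conditional expectation, and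
its faithfulness replaces the C*-norm of B in all cancellation arguments. Moreover the Fourier
transform h ↦ τ(h S(·)) is a bijection H → H⁰ that sends 1 to τ and obeys the exchange rule
`sum_fourier_smul`; this translates M(A) ⊗ H⁰ into multipliers of B.

1 → 3 (`IsFree.unique`): a conditional expectation F yields multipliers m_k = F(1 ⋊ k) of A with m_k
a = (k₁ · a) m_{k₂}. Up to the involution these are the slices of an element of M(A) ⊗ H⁰ that
satisfies the relation in the definition of freeness. Hence m_k = τ(k) m₁ = τ(k), which gives F = E.

3 → 2 (`centralizer_eq_of_unique`): let z be a multiplier of B that commutes with A. The map x ↦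
E(z* x z) is a positive A-bimodule map, and its restriction to A is multiplication by a central
multiplier d. If r > 0 dominates d, then r⁻¹(r E − d E + E(z* · z)) is again a conditional
expectation, so it equals E and E(z* x z) = d E(x). Polarization in 1 + c z gives E(x z) = E(x) m
with m central, and faithfulness then gives z = m.

2 → 1 (`isFree_of_centralizer_subset`): write x = ∑ᵢ mᵢ ⊗ φᵢ with φᵢ the Fourier transform of a
basis kᵢ of H. By the exchange rule, the relation in the definition of freeness says that z = ∑ᵢ mᵢ
⋊ kᵢ commutes with A. So z is some n in A' ∩ M(A), and transforming back gives x = n ⊗ τ. -/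

namespace CStarCoaction

open Coalgebra

/-! ### The antipode and the comultiplication -/

section Antipode
variable {H : Type*} [CStarAlgebra H] [CStarHopfAlgebra H]

variable (H) in
-- The axiom S(S(h*)*) = h makes h ↦ S(h*)* a left inverse of S. In finite dimension S is therefore
-- also surjective, and this is how the lemma is mostly used.
theorem antipode_injective :
    Function.Injective (CStarHopfAlgebra.antipode : H →ₗ[ℂ] H) := by
  refine Function.LeftInverse.injective
    (g := fun h ↦ star (CStarHopfAlgebra.antipode (star h))) fun h ↦ ?_
  have := CStarHopfAlgebra.antipode_star (star h)
  rw [star_star] at this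
  simp only [this, star_star]

theorem antipode_one' : (CStarHopfAlgebra.antipode (1 : H) : H) = 1 :=
  HopfAlgebra.antipode_one (R := ℂ) (A := H)

variable (H) in
/-- The map `h ↦ S(h₂) ⊗ S(h₁)`. -/
noncomputable def antipodeComul : H →ₗ[ℂ] H ⊗[ℂ] H :=
  TensorProduct.map CStarHopfAlgebra.antipode CStarHopfAlgebra.antipode ∘ₗ
    (TensorProduct.comm ℂ H H).toLinearMap ∘ₗ comul

theorem antipodeComul_apply (h : H) {ι : Type*} (r : Repr ℂ h ι) :
    antipodeComul H h = ∑ i ∈ r.index,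
      CStarHopfAlgebra.antipode (r.right i) ⊗ₜ[ℂ] CStarHopfAlgebra.antipode (r.left i) := by
  simp [antipodeComul, ← r.eq]

variable [FiniteDimensional ℂ H]

variable (H) in
-- In Sweedler notation, (S(h₂) ⊗ S(h₁)) Δ(h₃) collapses to 1 ⊗ S(h₁) h₂ and then to ε(h). This is
-- one half of the uniqueness of convolution inverses in Hom(H, H ⊗ H).
theorem antipodeComul_mul_comul :
    WithConv.toConv (antipodeComul H) * WithConv.toConv (comul (R := ℂ) (A := H)) = 1 := by
  ext h
  rw [(ℛ ℂ h).convMul_apply, LinearMap.convOne_apply]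
  have key := congrArg (LinearMap.mul' ℂ (H ⊗[ℂ] H) ∘ₗ TensorProduct.map
      (TensorProduct.map CStarHopfAlgebra.antipode CStarHopfAlgebra.antipode ∘ₗ
        (TensorProduct.comm ℂ H H).toLinearMap) comul ∘ₗ
      (TensorProduct.assoc ℂ H H H).symm.toLinearMap)
    (sum_tmul_tmul_eq (ℛ ℂ h) (fun i ↦ ℛ ℂ ((ℛ ℂ h).left i)) (fun i ↦ ℛ ℂ ((ℛ ℂ h).right i)))
  simp only [map_sum, LinearMap.comp_apply, LinearEquiv.coe_coe, TensorProduct.assoc_symm_tmul,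
    TensorProduct.map_tmul, TensorProduct.comm_tmul, LinearMap.mul'_apply] at key
  -- The inner collapse: (S(x₁) ⊗ 1) Δ(x₂) = 1 ⊗ x.
  have e (x : H) : ∑ j ∈ (ℛ ℂ x).index, (CStarHopfAlgebra.antipode ((ℛ ℂ x).left j) ⊗ₜ[ℂ] (1 : H)) *
      comul ((ℛ ℂ x).right j) = (1 : H) ⊗ₜ[ℂ] x := by
    rw [← Coaction.antipode_aux x]
    refine Finset.sum_congr rfl fun j _ ↦ ?_
    rw [← (ℛ ℂ ((ℛ ℂ x).right j)).eq, Finset.mul_sum]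
    simp
  simp only [antipodeComul_apply _ (ℛ ℂ ((ℛ ℂ h).left _)),
    Finset.sum_mul]
  rw [key]
  have e2 (i) : ∑ j ∈ (ℛ ℂ ((ℛ ℂ h).right i)).index,
      (CStarHopfAlgebra.antipode ((ℛ ℂ ((ℛ ℂ h).right i)).left j) ⊗ₜ[ℂ]
        CStarHopfAlgebra.antipode ((ℛ ℂ h).left i)) * comul ((ℛ ℂ ((ℛ ℂ h).right i)).right j) =
      (1 : H) ⊗ₜ[ℂ] (CStarHopfAlgebra.antipode ((ℛ ℂ h).left i) * (ℛ ℂ h).right i) := by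
    have := congrArg (fun z ↦ ((1 : H) ⊗ₜ[ℂ] CStarHopfAlgebra.antipode ((ℛ ℂ h).left i)) * z)
      (e ((ℛ ℂ h).right i))
    simpa [Finset.mul_sum, ← mul_assoc] using this
  simp only [e2, ← TensorProduct.tmul_sum]
  have h2 : ∑ i ∈ (ℛ ℂ h).index, CStarHopfAlgebra.antipode ((ℛ ℂ h).left i) *
      (ℛ ℂ h).right i = counit (R := ℂ) h • (1 : H) :=
    HopfAlgebra.sum_antipode_mul_eq_smul (ℛ ℂ h)
  rw [h2, TensorProduct.tmul_smul, Algebra.algebraMap_eq_smul_one, Algebra.TensorProduct.one_def]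

/-- The antipode reverses the comultiplication: `Δ(S(h)) = S(h₂) ⊗ S(h₁)`. -/
theorem comul_antipode (h : H) : comul (CStarHopfAlgebra.antipode h) = antipodeComul H h := by
  -- The map h ↦ S(h₂) ⊗ S(h₁) is a left convolution inverse of Δ and Δ ∘ S is a right one, so they
  -- agree.
  have h1 := antipodeComul_mul_comul H
  have h2 := LinearMap.comul_right_inv (R := ℂ) (C := H)
  have h3 := left_inv_eq_right_inv h1 h2
  exact (congrArg (fun f ↦ f.ofConv h) h3).symm

/-- `Δ(S(h)) = S(h₂) ⊗ S(h₁)`. -/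
noncomputable def reprAntipode (h : H) : Repr ℂ (CStarHopfAlgebra.antipode h) (H × H) where
  index := (ℛ ℂ h).index
  left i := CStarHopfAlgebra.antipode ((ℛ ℂ h).right i)
  right i := CStarHopfAlgebra.antipode ((ℛ ℂ h).left i)
  eq := by rw [comul_antipode, antipodeComul_apply h (ℛ ℂ h)]

/-- `Δ(S(h)*) = S(h₂)* ⊗ S(h₁)*`. -/
noncomputable def reprStarAntipode (h : H) :
    Repr ℂ (star (CStarHopfAlgebra.antipode h)) (H × H) where
  index := (ℛ ℂ h).index
  left i := star (CStarHopfAlgebra.antipode ((ℛ ℂ h).right i))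
  right i := star (CStarHopfAlgebra.antipode ((ℛ ℂ h).left i))
  eq := by
    rw [CStarHopfAlgebra.comul_star, ← (reprAntipode h).eq, star_sum]
    rfl

end Antipode

/-! ### Positivity of the Haar trace -/

section Trace
variable (H : Type*) [CStarAlgebra H]

/-- The trace of the regular representation. -/
noncomputable def regularTrace : H →ₗ[ℂ] ℂ := LinearMap.trace ℂ H ∘ₗ LinearMap.mul ℂ H

theorem regularTrace_apply (x : H) :
    regularTrace H x = LinearMap.trace ℂ H (LinearMap.mulLeft ℂ x) := rfl

variable [FiniteDimensional ℂ H]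

theorem regularTrace_one : regularTrace H 1 = Module.finrank ℂ H := by
  rw [regularTrace_apply, LinearMap.mulLeft_one, LinearMap.trace_id]

/-- For a basis that is orthonormal for (x, y) ↦ ω(x* y), the summands are the diagonal matrix
entries of left multiplication. Compatibility with the involution and positivity pass from ω to the
trace through this formula. -/
theorem exists_regularTrace_eq_sum [Nontrivial H] : ∃ (n : ℕ) (b : Module.Basis (Fin n) ℂ H)
    (ω : H →ₗ[ℂ] ℂ), (∀ x, ω (star x) = conj (ω x)) ∧ (∀ x ≠ 0, 0 < (ω (star x * x)).re) ∧
      ∀ x, regularTrace H x = ∑ i, ω (star (b i) * (x * b i)) := by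
  obtain ⟨ω, -, hs, hp⟩ := exists_faithful_functional (H := H)
  let c : InnerProductSpace.Core ℂ H :=
    { inner := fun x y ↦ ω (star x * y)
      conj_inner_symm := fun x y ↦ by rw [← hs, star_mul, star_star]
      re_inner_nonneg := fun x ↦ by
        by_cases h : x = 0
        · simp [h]
        · exact (hp x h).le
      add_left := fun x y z ↦ by simp [add_mul]
      smul_left := fun x y r ↦ by simp
      definite := fun x hx ↦ by
        by_contra h
        have := hp x h
        rw [hx] at this
        simp at this }
  obtain ⟨n, b, hb⟩ := exists_orthonormal_basis_of_core c
  have hb' : ∀ i j, ω (star (b i) * b j) = if i = j then 1 else 0 := hb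
  refine ⟨n, b, ω, hs, hp, fun x ↦ ?_⟩
  have hrepr (y : H) (i) : b.repr y i = ω (star (b i) * y) := by
    have h1 : ω (star (b i) * ∑ j, b.repr y j • b j) = b.repr y i := by
      simp only [Finset.mul_sum, mul_smul_comm, map_sum, map_smul, hb']
      simp
    rw [← h1, b.sum_repr]
  rw [regularTrace_apply, LinearMap.trace_eq_matrix_trace ℂ b, Matrix.trace]
  refine Finset.sum_congr rfl fun i _ ↦ ?_
  rw [Matrix.diag_apply, LinearMap.toMatrix_apply, hrepr, LinearMap.mulLeft_apply]

theorem regularTrace_star [Nontrivial H] (x : H) :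
    regularTrace H (star x) = conj (regularTrace H x) := by
  obtain ⟨n, b, ω, hs, -, ht⟩ := exists_regularTrace_eq_sum H
  rw [ht, ht, map_sum]
  refine Finset.sum_congr rfl fun i _ ↦ ?_
  rw [← hs, star_mul, star_mul, star_star, mul_assoc]

theorem regularTrace_pos [Nontrivial H] {x : H} (hx : x ≠ 0) :
    0 < (regularTrace H (star x * x)).re := by
  obtain ⟨n, b, ω, -, hp, ht⟩ := exists_regularTrace_eq_sum H
  have e (i) : star (b i) * (star x * x * b i) = star (x * b i) * (x * b i) := by
    simp only [star_mul, mul_assoc]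
  have hnn (y : H) : 0 ≤ (ω (star y * y)).re := by
    by_cases h : y = 0
    · simp [h]
    · exact (hp y h).le
  rw [ht, Complex.re_sum]
  simp only [e]
  refine Finset.sum_pos' (fun i _ ↦ hnn _) ?_
  by_contra! hcon
  refine hx ?_
  have h0 (i) : x * b i = 0 := by
    by_contra h
    exact absurd (hcon i (Finset.mem_univ i)) (not_le.mpr (hp _ h))
  have h1 : LinearMap.mulLeft ℂ x = 0 := b.ext fun i ↦ h0 i
  simpa using congrArg (fun f ↦ f 1) h1

end Trace

/-! ### The Haar trace as normalized regular trace, and the Fourier transform -/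

section Haar
variable (H : Type*) [CStarAlgebra H] [CStarHopfAlgebra H]

include H in
theorem nontrivial_of_cstarHopfAlgebra : Nontrivial H :=
  ⟨1, 0, fun h ↦ by
    have := congrArg (counit (R := ℂ)) h
    rw [CStarHopfAlgebra.counit_one, map_zero] at this
    exact one_ne_zero this⟩

/-- The map `c ⊗ u ↦ Δ(c) (u ⊗ 1)`. -/
noncomputable def regularMap : H ⊗[ℂ] H →ₗ[ℂ] H ⊗[ℂ] H :=
  LinearMap.mul' ℂ (H ⊗[ℂ] H) ∘ₗ
    TensorProduct.map comul ((TensorProduct.mk ℂ H H).flip 1)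

theorem regularMap_tmul (c u : H) : regularMap H (c ⊗ₜ u) = comul c * (u ⊗ₜ[ℂ] 1) := rfl

/-- The adjoint of Δ(c)(u ⊗ 1) is (u* ⊗ 1)Δ(c*), which `cancelMap` undoes; a flip and another
adjoint recover c ⊗ u. -/
theorem regularMap_injective : Function.Injective (regularMap H) := by
  refine Function.LeftInverse.injective
    (g := fun z ↦ star (TensorProduct.comm ℂ H H (cancelMap (star z)))) fun z ↦ ?_
  induction z with
  | zero => simp
  | add x y hx hy =>
    simp only [map_add, star_add] at hx hy ⊢
    rw [hx, hy]
  | tmul c u =>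
    have := cancelMap_apply (star u) (star c)
    rw [comulHom_star] at this
    simp only [regularMap_tmul, star_mul, TensorProduct.star_tmul, star_one]
    erw [this]
    simp

variable [FiniteDimensional ℂ H]

variable {H} in
-- The tensor square of the regular representation is equivalent, through `regularMap`, to dim H
-- copies of the regular representation. The identity compares the traces of h on both sides, and
-- says that the normalized trace is idempotent for convolution.
theorem sum_regularTrace_mul (h : H) {ι : Type*} (r : Repr ℂ h ι) :
    ∑ i ∈ r.index, regularTrace H (r.left i) * regularTrace H (r.right i) =
      Module.finrank ℂ H * regularTrace H h := by
  let V := LinearEquiv.ofInjectiveEndo (regularMap H) (regularMap_injective H)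
  let f : Module.End ℂ (H ⊗[ℂ] H) := LinearMap.mulLeft ℂ (comul h)
  have hf : f = ∑ i ∈ r.index, TensorProduct.map (LinearMap.mulLeft ℂ (r.left i))
      (LinearMap.mulLeft ℂ (r.right i)) := by
    refine TensorProduct.ext' fun x y ↦ ?_
    simp [f, ← r.eq, Finset.sum_mul]
  have hV : f = V.conj (TensorProduct.map (LinearMap.mulLeft ℂ h) LinearMap.id) := by
    have h1 : f ∘ₗ V.toLinearMap =
        V.toLinearMap ∘ₗ TensorProduct.map (LinearMap.mulLeft ℂ h) LinearMap.id := by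
      refine TensorProduct.ext' fun c u ↦ ?_
      change comul h * regularMap H (c ⊗ₜ u) = regularMap H ((h * c) ⊗ₜ u)
      rw [regularMap_tmul, regularMap_tmul, CStarHopfAlgebra.comul_mul, mul_assoc]
    rw [LinearEquiv.conj_apply, ← h1, LinearMap.comp_assoc]
    simp
  have h1 : LinearMap.trace ℂ _ f = Module.finrank ℂ H * regularTrace H h := by
    rw [hV, LinearMap.trace_conj', LinearMap.trace_tensorProduct', LinearMap.trace_id, mul_comm]
    rfl
  rw [← h1, hf, map_sum]
  simp only [LinearMap.trace_tensorProduct', regularTrace_apply]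

variable {H}

/-- The relation φ τ = φ(1) τ for all φ, read inside H; functionals separate points. -/
theorem sum_haar_right_smul (h : H) {ι : Type*} (r : Repr ℂ h ι) :
    ∑ i ∈ r.index, haar H (r.right i) • r.left i = haar H h • (1 : H) := by
  rw [← sub_eq_zero, ← Module.forall_dual_apply_eq_zero_iff ℂ]
  intro φ
  have h1 := congrArg (fun ψ : DualHopf H ↦ ψ h) ((isHaar_haar H).2 ((DualHopf.toDual H).symm φ)).1
  simp only [DualHopf.mul_apply _ _ _ r, DualHopf.smul_apply] at h1
  change ∑ i ∈ r.index, φ _ * _ = φ 1 * _ at h1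
  simp only [map_sub, map_sum, map_smul, smul_eq_mul, sub_eq_zero]
  rw [mul_comm, ← h1]
  exact Finset.sum_congr rfl fun i _ ↦ mul_comm _ _

theorem sum_haar_left_smul (h : H) {ι : Type*} (r : Repr ℂ h ι) :
    ∑ i ∈ r.index, haar H (r.left i) • r.right i = haar H h • (1 : H) := by
  rw [← sub_eq_zero, ← Module.forall_dual_apply_eq_zero_iff ℂ]
  intro φ
  have h1 := congrArg (fun ψ : DualHopf H ↦ ψ h) ((isHaar_haar H).2 ((DualHopf.toDual H).symm φ)).2
  simp only [DualHopf.mul_apply _ _ _ r, DualHopf.smul_apply] at h1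
  change ∑ i ∈ r.index, _ * φ _ = φ 1 * _ at h1
  simp only [map_sub, map_sum, map_smul, smul_eq_mul, sub_eq_zero]
  rw [h1, mul_comm]

theorem haar_one : haar H (1 : H) = 1 := (isHaar_haar H).1

/-- The Haar trace is the normalized trace of the regular representation. -/
theorem haar_apply (h : H) :
    haar H h = (((Module.finrank ℂ H : ℝ)⁻¹ : ℝ) : ℂ) * regularTrace H h := by
  have := nontrivial_of_cstarHopfAlgebra H
  have hn : (0 : ℝ) < Module.finrank ℂ H := by exact_mod_cast Module.finrank_pos
  let e : H →ₗ[ℂ] ℂ := (((Module.finrank ℂ H : ℝ)⁻¹ : ℝ) : ℂ) • regularTrace H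
  have he1 : e 1 = 1 := by
    have : (Module.finrank ℂ H : ℂ) ≠ 0 := by exact_mod_cast hn.ne'
    simp [e, regularTrace_one, this]
  have hes (x) : e (star x) = conj (e x) := by
    simp [e, regularTrace_star]
  have hep (x : H) (hx : x ≠ 0) : 0 < (e (star x * x)).re := by
    rw [LinearMap.smul_apply, smul_eq_mul, Complex.re_ofReal_mul]
    exact mul_pos (inv_pos.mpr hn) (regularTrace_pos H hx)
  have hconv (x : H) : ∑ i ∈ (ℛ ℂ x).index, e ((ℛ ℂ x).left i) * e ((ℛ ℂ x).right i) = e x := by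
    have h0 : (Module.finrank ℂ H : ℂ) ≠ 0 := by exact_mod_cast hn.ne'
    have := sum_regularTrace_mul x (ℛ ℂ x)
    have h3 (a b : H) : e a * e b = ((Module.finrank ℂ H : ℂ)⁻¹ * (Module.finrank ℂ H : ℂ)⁻¹) *
        (regularTrace H a * regularTrace H b) := by
      simp [e]; ring
    simp only [h3]
    rw [← Finset.mul_sum, this]
    simp [e]
    field_simp
  -- As e ∗ e = e, slicing by e is a projection, and `fixed_scalar` makes its range scalar because e
  -- is faithful. So e is itself invariant.
  have hidem (x : H) : convRight (comulHom H) e (convRight (comulHom H) e x) =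
      convRight (comulHom H) e x := by
    rw [convRight_conv]
    congr 2
    refine LinearMap.ext fun y ↦ ?_
    rw [LinearMap.comp_apply, convRight_comulOpHom _ _ (ℛ ℂ y), map_sum]
    simp only [map_smul, smul_eq_mul]
    exact hconv y
  obtain ⟨c, hc⟩ := fixed_scalar e he1 hes hep (comulHom H) comulHom_star cancelMap
    cancelMap_apply _ (hidem h)
  rw [convRight_comulHom _ _ (ℛ ℂ h)] at hc
  have h1 := congrArg e hc
  simp only [map_sum, map_smul, smul_eq_mul, he1, mul_one] at h1
  have h2 : c = e h := by
    rw [← h1, ← hconv]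
    exact Finset.sum_congr rfl fun i _ ↦ mul_comm _ _
  -- The number e(h₂) τ(h₁) is computed twice: invariance of e gives e(h), invariance of τ gives
  -- τ(h).
  have h3 := congrArg (haar H) hc
  have h4 := congrArg e (sum_haar_left_smul h (ℛ ℂ h))
  simp only [map_sum, map_smul, smul_eq_mul, he1, haar_one, mul_one] at h3 h4
  change _ = e h
  rw [← h2, ← h3, ← h4]
  exact Finset.sum_congr rfl fun i _ ↦ mul_comm _ _

theorem haar_star (h : H) : haar H (star h) = conj (haar H h) := by
  have := nontrivial_of_cstarHopfAlgebra H
  simp [haar_apply, regularTrace_star]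

theorem haar_star_mul_self_pos {h : H} (hh : h ≠ 0) : 0 < (haar H (star h * h)).re := by
  have := nontrivial_of_cstarHopfAlgebra H
  rw [haar_apply, Complex.re_ofReal_mul]
  exact mul_pos (inv_pos.mpr (by exact_mod_cast Module.finrank_pos)) (regularTrace_pos H hh)

variable (H) in
theorem exists_haar_orthonormal_basis : ∃ (n : ℕ) (b : Module.Basis (Fin n) ℂ H),
    ∀ i j, haar H (star (b i) * b j) = if i = j then 1 else 0 := by
  let c : InnerProductSpace.Core ℂ H :=
    { inner := fun x y ↦ haar H (star x * y)
      conj_inner_symm := fun x y ↦ by rw [← haar_star, star_mul, star_star]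
      re_inner_nonneg := fun x ↦ by
        by_cases h : x = 0
        · simp [h]
        · exact (haar_star_mul_self_pos h).le
      add_left := fun x y z ↦ by simp [add_mul]
      smul_left := fun x y r ↦ by simp
      definite := fun x hx ↦ by
        by_contra h
        have := haar_star_mul_self_pos h
        rw [hx] at this
        simp at this }
  exact exists_orthonormal_basis_of_core c

/-- As S reverses Δ, left invariance of τ turns into right invariance of τ ∘ S. Evaluating τ(h₁)
τ(S(h₂)) by each invariance identifies the two functionals. -/
theorem haar_antipode (h : H) : haar H (CStarHopfAlgebra.antipode h) = haar H h := by
  let σ : H →ₗ[ℂ] ℂ := DualHopf.toDual H (haar H) ∘ₗ CStarHopfAlgebra.antipode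
  have h1 : ∑ i ∈ (ℛ ℂ h).index, σ ((ℛ ℂ h).right i) • (ℛ ℂ h).left i = σ h • (1 : H) := by
    apply antipode_injective H
    simp only [map_sum, map_smul, antipode_one']
    exact sum_haar_left_smul _ (reprAntipode h)
  have h2 := congrArg (haar H) h1
  have h3 := congrArg σ (sum_haar_left_smul h (ℛ ℂ h))
  have h4 : σ 1 = 1 := by
    change haar H (CStarHopfAlgebra.antipode (1 : H)) = 1
    rw [antipode_one', haar_one]
  simp only [map_sum, map_smul, smul_eq_mul, haar_one, mul_one, h4] at h2 h3
  change σ h = _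
  rw [← h2, ← h3]
  exact Finset.sum_congr rfl fun i _ ↦ mul_comm _ _

/-- The Fourier transform `H → H⁰`, which maps `h` to `k ↦ τ(h S(k))`. -/
noncomputable def fourier : H →ₗ[ℂ] DualHopf H where
  toFun h := (DualHopf.toDual H).symm (DualHopf.toDual H (haar H) ∘ₗ LinearMap.mulLeft ℂ h ∘ₗ
    CStarHopfAlgebra.antipode)
  map_add' x y := DualHopf.ext fun k ↦ by
    change haar H ((x + y) * _) = haar H (x * _) + haar H (y * _)
    rw [add_mul, map_add]
  map_smul' c x := DualHopf.ext fun k ↦ by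
    change haar H ((c • x) * _) = c * haar H (x * _)
    rw [smul_mul_assoc, map_smul, smul_eq_mul]

theorem fourier_apply (h k : H) : fourier h k = haar H (h * CStarHopfAlgebra.antipode k) := rfl

theorem fourier_one : fourier (1 : H) = haar H :=
  DualHopf.ext fun k ↦ by rw [fourier_apply, one_mul, haar_antipode]

/-- For h ≠ 0 choose k with S(k) = h*; the transform of h at k is τ(h h*) > 0. -/
theorem fourier_injective : Function.Injective (fourier (H := H)) := by
  rw [← LinearMap.ker_eq_bot, LinearMap.ker_eq_bot']
  intro h hh
  by_contra h0
  have hsurj := LinearMap.surjective_of_injective (antipode_injective H)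
  obtain ⟨k, hk⟩ := hsurj (star h)
  have h1 := congrArg (fun φ : DualHopf H ↦ φ k) hh
  simp only [fourier_apply, hk] at h1
  have h2 := haar_star_mul_self_pos (h := star h) (by simpa using h0)
  rw [star_star, h1] at h2
  exact lt_irrefl _ h2

/-- `τ(h₂ S(k)) h₁ = τ(h S(k₁)) k₂`. -/
theorem sum_fourier_smul (h k : H) {ι κ : Type*} (r : Repr ℂ h ι) (s : Repr ℂ k κ) :
    ∑ i ∈ r.index, fourier (r.right i) k • r.left i =
      ∑ j ∈ s.index, fourier h (s.left j) • s.right j := by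
  -- Invariance of τ applied to h S(y), whose coproduct is h₁ S(y₂) ⊗ h₂ S(y₁). With y = k₁ and
  -- right multiplication by k₂ this leaves a factor S(k₂) k₃ to cancel.
  have h1 (y : H) : fourier h y • (1 : H) = ∑ l ∈ (ℛ ℂ y).index, ∑ i ∈ r.index,
      fourier (r.right i) ((ℛ ℂ y).left l) •
        (r.left i * CStarHopfAlgebra.antipode ((ℛ ℂ y).right l)) := by
    let t : Repr ℂ (h * CStarHopfAlgebra.antipode y) (ι × (H × H)) :=
      { index := r.index ×ˢ (ℛ ℂ y).index
        left := fun p ↦ r.left p.1 * CStarHopfAlgebra.antipode ((ℛ ℂ y).right p.2)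
        right := fun p ↦ r.right p.1 * CStarHopfAlgebra.antipode ((ℛ ℂ y).left p.2)
        eq := by
          rw [CStarHopfAlgebra.comul_mul, ← r.eq, comul_antipode,
            antipodeComul_apply y (ℛ ℂ y), Finset.sum_mul_sum, Finset.sum_product]
          simp only [Algebra.TensorProduct.tmul_mul_tmul] }
    rw [fourier_apply, ← sum_haar_right_smul _ t, Finset.sum_product_right]
    rfl
  have h2 (x : H) : ∑ i ∈ (ℛ ℂ x).index, CStarHopfAlgebra.antipode ((ℛ ℂ x).left i) *
      (ℛ ℂ x).right i = counit (R := ℂ) x • (1 : H) :=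
    HopfAlgebra.sum_antipode_mul_eq_smul (ℛ ℂ x)
  have h3 (x : H) : ∑ j ∈ s.index, (∑ l ∈ (ℛ ℂ (s.left j)).index,
      fourier x ((ℛ ℂ (s.left j)).left l) •
        (CStarHopfAlgebra.antipode ((ℛ ℂ (s.left j)).right l) * s.right j)) =
      fourier x k • 1 := by
    have key := congrArg (TensorProduct.lift (LinearMap.lsmul ℂ H) ∘ₗ
      TensorProduct.map (DualHopf.toDual H (fourier x)) (LinearMap.mul' ℂ H ∘ₗ
        TensorProduct.map CStarHopfAlgebra.antipode LinearMap.id))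
      (sum_tmul_tmul_eq s (fun i ↦ ℛ ℂ (s.left i)) (fun i ↦ ℛ ℂ (s.right i)))
    simp only [map_sum, LinearMap.comp_apply, TensorProduct.map_tmul, LinearMap.mul'_apply,
      LinearMap.id_apply, TensorProduct.lift.tmul, LinearMap.lsmul_apply, ← Finset.smul_sum,
      h2] at key
    refine key.trans ?_
    have h4 := congrArg (TensorProduct.rid ℂ ℂ ∘ (DualHopf.toDual H (fourier x)).rTensor ℂ)
      (sum_tmul_counit_eq s)
    simp only [Function.comp_apply, map_sum, LinearMap.rTensor_tmul, TensorProduct.rid_tmul,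
      smul_eq_mul, one_mul] at h4
    simp only [smul_smul, ← Finset.sum_smul]
    congr 1
    refine Eq.trans (Finset.sum_congr rfl fun j _ ↦ mul_comm _ _) h4
  have h5 (j) : fourier h (s.left j) • s.right j = ∑ l ∈ (ℛ ℂ (s.left j)).index, ∑ i ∈ r.index,
      fourier (r.right i) ((ℛ ℂ (s.left j)).left l) • (r.left i *
        (CStarHopfAlgebra.antipode ((ℛ ℂ (s.left j)).right l) * s.right j)) := by
    have := congrArg (· * s.right j) (h1 (s.left j))
    simpa only [smul_mul_assoc, one_mul, Finset.sum_mul, mul_assoc] using this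
  have h6 (i) := congrArg (r.left i * ·) (h3 (r.right i))
  simp only [Finset.mul_sum, mul_smul_comm, mul_one] at h6
  simp only [h5, ← h6]
  rw [Finset.sum_comm]
  exact Finset.sum_congr rfl fun j _ ↦ Finset.sum_comm

end Haar

end CStarCoaction

namespace CStarCoaction

/-! ### Multipliers of a C*-algebra -/

section DoubleCentralizer
variable {A : Type*} [NonUnitalCStarAlgebra A]

theorem eq_zero_of_forall_mul_eq_zero {a : A} (h : ∀ b : A, a * b = 0) : a = 0 :=
  CStarRing.mul_star_self_eq_zero_iff _ |>.mp (h _)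

theorem eq_zero_of_forall_mul_eq_zero' {a : A} (h : ∀ b : A, b * a = 0) : a = 0 :=
  CStarRing.star_mul_self_eq_zero_iff _ |>.mp (h _)

theorem eq_of_forall_mul_eq {a a' : A} (h : ∀ b : A, b * a = b * a') : a = a' :=
  sub_eq_zero.mp (eq_zero_of_forall_mul_eq_zero' fun b ↦ by rw [mul_sub, h, sub_self])

theorem eq_of_forall_mul_eq' {a a' : A} (h : ∀ b : A, a * b = a' * b) : a = a' :=
  sub_eq_zero.mp (eq_zero_of_forall_mul_eq_zero fun b ↦ by rw [sub_mul, h, sub_self])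

/-- Double centralizers of a C*-algebra are automatically continuous. -/
theorem exists_doubleCentralizer (L R : A →ₗ[ℂ] A) (h : ∀ x y, R x * y = x * L y) :
    ∃ m : 𝓜(ℂ, A), (∀ a, m.fst a = L a) ∧ ∀ a, m.snd a = R a := by
  -- Closed graph: if uₙ → x and L uₙ → y, then b y = lim b L(uₙ) = lim R(b) uₙ = R(b) x = b L(x)
  -- for every b.
  have hL : Continuous L := by
    refine L.continuous_of_seq_closed_graph fun u x y hu hv ↦ eq_of_forall_mul_eq fun b ↦ ?_
    have h1 := hv.const_mul b
    simp only [Function.comp_apply, ← h] at h1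
    rw [← h]
    exact tendsto_nhds_unique h1 (hu.const_mul (R b))
  have hR : Continuous R := by
    refine R.continuous_of_seq_closed_graph fun u x y hu hv ↦ eq_of_forall_mul_eq' fun b ↦ ?_
    have h1 := hv.mul_const b
    simp only [Function.comp_apply, h] at h1
    rw [h]
    exact tendsto_nhds_unique h1 (hu.mul_const (L b))
  exact ⟨⟨(⟨L, hL⟩, ⟨R, hR⟩), h⟩, fun _ ↦ rfl, fun _ ↦ rfl⟩

theorem doubleCentralizer_ext_fst {m n : 𝓜(ℂ, A)} (h : ∀ a, m.fst a = n.fst a) : m = n := by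
  have hsnd (a : A) : m.snd a = n.snd a :=
    eq_of_forall_mul_eq' fun b ↦ by rw [m.central, n.central, h]
  exact DoubleCentralizer.ext ℂ A _ _ (Prod.ext (ContinuousLinearMap.ext h)
    (ContinuousLinearMap.ext hsnd))

theorem doubleCentralizer_fst_mul (m : 𝓜(ℂ, A)) (a b : A) : m.fst (a * b) = m.fst a * b :=
  eq_of_forall_mul_eq fun c ↦ by rw [← m.central, ← mul_assoc, ← mul_assoc, m.central]

theorem doubleCentralizer_mul_coe (m : 𝓜(ℂ, A)) (a : A) :
    m * (a : 𝓜(ℂ, A)) = ((m.fst a : A) : 𝓜(ℂ, A)) :=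
  doubleCentralizer_ext_fst fun b ↦ doubleCentralizer_fst_mul m a b

theorem doubleCentralizer_coe_mul (m : 𝓜(ℂ, A)) (a : A) :
    (a : 𝓜(ℂ, A)) * m = ((m.snd a : A) : 𝓜(ℂ, A)) :=
  doubleCentralizer_ext_fst fun b ↦ (m.central a b).symm

theorem doubleCentralizer_coe_injective :
    Function.Injective fun a : A ↦ (a : 𝓜(ℂ, A)) := fun _ _ h ↦
  eq_of_forall_mul_eq' fun c ↦ congrArg (fun m : 𝓜(ℂ, A) ↦ m.fst c) h

theorem mem_centralizer_iff (m : 𝓜(ℂ, A)) :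
    m ∈ Set.centralizer (Set.range fun a : A ↦ (a : 𝓜(ℂ, A))) ↔ ∀ a, m.fst a = m.snd a := by
  simp only [Set.mem_centralizer_iff, Set.forall_mem_range, doubleCentralizer_coe_mul,
    doubleCentralizer_mul_coe]
  exact forall_congr' fun a ↦ ⟨fun h ↦ (doubleCentralizer_coe_injective h).symm, fun h ↦ by rw [h]⟩

theorem eq_zero_of_mul_coe_eq_zero {m : 𝓜(ℂ, A)} (h : ∀ a : A, m * (a : 𝓜(ℂ, A)) = 0) :
    m = 0 :=
  doubleCentralizer_ext_fst fun a ↦ by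
    have h1 := h a
    rw [doubleCentralizer_mul_coe] at h1
    exact doubleCentralizer_coe_injective (h1.trans (map_zero DoubleCentralizer.coeHom).symm)

theorem eq_zero_of_coe_mul_eq_zero {m : 𝓜(ℂ, A)} (h : ∀ a : A, (a : 𝓜(ℂ, A)) * m = 0) :
    m = 0 := by
  refine doubleCentralizer_ext_fst fun a ↦ eq_of_forall_mul_eq fun b ↦ ?_
  have h1 : ((b : 𝓜(ℂ, A)) * m).fst a = 0 := by rw [h]; rfl
  refine Eq.trans h1 ?_
  rw [DoubleCentralizer.zero_fst]
  simp

/-- A central multiplier `d` for which all `c* d c` are self-adjoint is self-adjoint. -/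
theorem isSelfAdjoint_of_central {d : 𝓜(ℂ, A)} (hd : ∀ a, d.fst a = d.snd a)
    (h : ∀ c : A, IsSelfAdjoint (star c * d.fst c)) : IsSelfAdjoint d := by
  have hc (a : A) : (a : 𝓜(ℂ, A)) * d = d * a :=
    (mem_centralizer_iff d).mpr hd _ ⟨a, rfl⟩
  have hstar (a : A) : ((star a : A) : 𝓜(ℂ, A)) = star (a : 𝓜(ℂ, A)) :=
    map_star (DoubleCentralizer.coeHom : A →⋆ₙₐ[ℂ] 𝓜(ℂ, A)) a
  have hcs (a : A) : (a : 𝓜(ℂ, A)) * star d = star d * a := by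
    have h1 := congrArg star (hc (star a))
    rw [star_mul, star_mul, hstar, star_star] at h1
    exact h1.symm
  have hmul (a b : A) : ((a * b : A) : 𝓜(ℂ, A)) = (a : 𝓜(ℂ, A)) * b :=
    map_mul (DoubleCentralizer.coeHom : A →⋆ₙₐ[ℂ] 𝓜(ℂ, A)) a b
  set q := star d - d with hq
  have hqc (a : A) : (a : 𝓜(ℂ, A)) * q = q * a := by rw [mul_sub, sub_mul, hc, hcs]
  -- Self-adjointness of c* d c reads c* d* c = c* d c; centrality pulls d and d* out in front.
  have h1 (c : A) : q * (star (c : 𝓜(ℂ, A)) * c) = 0 := by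
    have h2 := congrArg (fun a : A ↦ (a : 𝓜(ℂ, A))) (h c).star_eq
    simp only [star_mul, star_star, hmul, hstar] at h2
    rw [← doubleCentralizer_mul_coe, star_mul] at h2
    have h3 : star (c : 𝓜(ℂ, A)) * star d * c = star d * (star (c : 𝓜(ℂ, A)) * c) := by
      rw [← hstar, hcs, mul_assoc]
    rw [h3, ← mul_assoc (star (c : 𝓜(ℂ, A))), ← hstar, hc, hstar, mul_assoc] at h2
    rw [hq, sub_mul, h2, sub_self]
  refine sub_eq_zero.mp (eq_zero_of_mul_coe_eq_zero fun c ↦ ?_)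
  have h4 : (q * c) * star (q * (c : 𝓜(ℂ, A))) = 0 := by
    have h5 := h1 (star c)
    rw [hstar, star_star] at h5
    rw [star_mul, ← mul_assoc, mul_assoc q, h5, zero_mul]
  exact CStarRing.mul_star_self_eq_zero_iff _ |>.mp h4

theorem star_mul_self_add_star_mul_self (a b : A) :
    ∃ c : A, star a * a + star b * b = star c * c := by
  let _ := CStarAlgebra.spectralOrder A
  have _ := CStarAlgebra.spectralOrderedRing A
  exact CStarAlgebra.nonneg_iff_eq_star_mul_self.mp
    (add_nonneg (star_mul_self_nonneg a) (star_mul_self_nonneg b))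

theorem sum_star_mul_self {ι : Type*} (s : Finset ι) (f : ι → A) :
    ∃ c : A, ∑ i ∈ s, star (f i) * f i = star c * c := by
  let _ := CStarAlgebra.spectralOrder A
  have _ := CStarAlgebra.spectralOrderedRing A
  exact CStarAlgebra.nonneg_iff_eq_star_mul_self.mp
    (Finset.sum_nonneg fun i _ ↦ star_mul_self_nonneg (f i))

theorem eq_zero_of_sum_star_mul_self {ι : Type*} (s : Finset ι) (f : ι → A)
    (h : ∑ i ∈ s, star (f i) * f i = 0) : ∀ i ∈ s, f i = 0 := by
  let _ := CStarAlgebra.spectralOrder A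
  have _ := CStarAlgebra.spectralOrderedRing A
  intro i hi
  have := (Finset.sum_eq_zero_iff_of_nonneg fun i _ ↦ star_mul_self_nonneg (f i)).mp h i hi
  exact CStarRing.star_mul_self_eq_zero_iff _ |>.mp this

/-- The bound is r = ‖d‖ + 1; the added 1 keeps r invertible even for d = 0. -/
theorem exists_sub_eq_star_mul_self {d : 𝓜(ℂ, A)} (hd : IsSelfAdjoint d) :
    ∃ (r : ℝ) (e : 𝓜(ℂ, A)), 0 < r ∧ (r : ℂ) • 1 - d = star e * e := by
  let _ := CStarAlgebra.spectralOrder 𝓜(ℂ, A)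
  have _ := CStarAlgebra.spectralOrderedRing 𝓜(ℂ, A)
  have h1 : d ≤ algebraMap ℝ 𝓜(ℂ, A) (‖d‖ + 1) := hd.le_algebraMap_norm_self.trans
    (algebraMap_mono _ (by linarith))
  obtain ⟨e, he⟩ := CStarAlgebra.nonneg_iff_eq_star_mul_self.mp (sub_nonneg.mpr h1)
  refine ⟨‖d‖ + 1, e, by positivity, ?_⟩
  rw [← he, Algebra.algebraMap_eq_smul_one]
  congr 1

end DoubleCentralizer

end CStarCoaction

namespace CStarCoaction

/-! ### Unique conditional expectations -/

section Expectation
variable {A B : Type*} [NonUnitalCStarAlgebra A] [NonUnitalRing B] [StarRing B] [Module ℂ B]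

/-- Here B is only a `*`-algebra. Faithfulness of E excludes nonzero annihilators and so supplies
the cancellation that a C*-norm would give. -/
theorem eq_zero_of_forall_mul_left_eq_zero {E : B →ₗ[ℂ] A} (hf : ∀ x, E (star x * x) = 0 → x = 0)
    {x : B} (h : ∀ y, y * x = 0) : x = 0 :=
  hf x (by rw [h, map_zero])

theorem eq_zero_of_forall_apply_mul_eq_zero {E : B →ₗ[ℂ] A}
    (hf : ∀ x, E (star x * x) = 0 → x = 0) {x : B} (h : ∀ y, E (y * x) = 0) : x = 0 :=
  hf x (h _)

theorem eq_zero_of_forall_mul_right_eq_zero {E : B →ₗ[ℂ] A}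
    (hf : ∀ x, E (star x * x) = 0 → x = 0) {x : B} (h : ∀ y, x * y = 0) : x = 0 :=
  star_eq_zero.mp (hf (star x) (by rw [star_star, h, map_zero]))

theorem Multiplier.right_mul {E : B →ₗ[ℂ] A} (hf : ∀ x, E (star x * x) = 0 → x = 0)
    (z : Multiplier B) (x y : B) : z.right (x * y) = x * z.right y := by
  refine sub_eq_zero.mp (eq_zero_of_forall_mul_right_eq_zero hf fun w ↦ ?_)
  rw [sub_mul, z.central, mul_assoc x y, mul_assoc x (z.right y), z.central, sub_self]

variable [StarModule ℂ B]

/-- The map `x ↦ E(z* x z)`. -/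
def compress (E : B →ₗ[ℂ] A) (z : Multiplier B) : B →ₗ[ℂ] A where
  toFun x := E (star (z.right (star (z.right x))))
  map_add' x y := by simp
  map_smul' c x := by simp

theorem compress_apply (E : B →ₗ[ℂ] A) (z : Multiplier B) (x : B) :
    compress E z x = E (star (z.right (star (z.right x)))) := rfl

theorem compress_star_mul_self {E : B →ₗ[ℂ] A} (hf : ∀ x, E (star x * x) = 0 → x = 0)
    (z : Multiplier B) (x : B) :
    compress E z (star x * x) = E (star (z.right x) * z.right x) := by
  rw [compress_apply, z.right_mul hf, star_mul, star_star, z.right_mul hf, star_mul, star_star]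

variable {ι : A →⋆ₙₐ[ℂ] B} {E : B →ₗ[ℂ] A}

theorem compress_left_module (hE : IsConditionalExpectation ι E)
    (hf : ∀ x, E (star x * x) = 0 → x = 0) {z : Multiplier B}
    (hz : ∀ a y, z.right (y * ι a) = z.right y * ι a) (a : A) (x : B) :
    compress E z (ι a * x) = a * compress E z x := by
  rw [compress_apply, z.right_mul hf, star_mul, ← map_star ι, hz, star_mul, ← map_star ι, star_star,
    hE.left_module, compress_apply]

theorem compress_right_module (hE : IsConditionalExpectation ι E)
    (hf : ∀ x, E (star x * x) = 0 → x = 0) {z : Multiplier B}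
    (hz : ∀ a y, z.right (y * ι a) = z.right y * ι a) (x : B) (a : A) :
    compress E z (x * ι a) = compress E z x * a := by
  rw [compress_apply, hz, star_mul, z.right_mul hf, star_mul, star_star, hE.right_module,
    compress_apply]

/-- If `E` is faithful and the only conditional expectation, then `E(z* x z) = E(z* E(x) z)` for all
multipliers `z` that commute with `A`. -/
theorem compress_eq_of_unique (hE : IsConditionalExpectation ι E)
    (hf : ∀ x, E (star x * x) = 0 → x = 0)
    (hu : ∀ F : B →ₗ[ℂ] A, IsConditionalExpectation ι F → F = E) {z : Multiplier B}
    (hz : ∀ a y, z.right (y * ι a) = z.right y * ι a) (x : B) :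
    compress E z x = compress E z (ι (E x)) := by
  let g : A →ₗ[ℂ] A := compress E z ∘ₗ (ι : A →ₗ[ℂ] B)
  have hg (a : A) : g a = compress E z (ι a) := rfl
  have hgl (a b : A) : g (a * b) = a * g b := by
    rw [hg, map_mul, compress_left_module hE hf hz, hg]
  have hgr (a b : A) : g (a * b) = g a * b := by
    rw [hg, map_mul, compress_right_module hE hf hz, hg]
  -- The multiplier d plays the role of E(z* z), and is central because g is a bimodule map.
  obtain ⟨d, hd1, hd2⟩ := exists_doubleCentralizer g g fun x y ↦ by rw [← hgl, hgr]
  have hsq (c : A) : ∃ f, star c * g c = star f * f := by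
    rw [← hgl, hg, map_mul, map_star, compress_star_mul_self hf]
    exact hE.positive _
  have hdsa : IsSelfAdjoint d := isSelfAdjoint_of_central (fun a ↦ by rw [hd1, hd2]) fun c ↦ by
    obtain ⟨f, hf⟩ := hsq c
    rw [hd1, hf]
    exact .star_mul_self f
  obtain ⟨r, e, hr, he⟩ := exists_sub_eq_star_mul_self hdsa
  have hr' : (r : ℂ) ≠ 0 := by exact_mod_cast hr.ne'
  -- A perturbation of E by E(z* x z). Subtracting d E(x) restores the identity on A, and the term r
  -- E with r ≥ d restores positivity.
  let F : B →ₗ[ℂ] A := (r : ℂ)⁻¹ • ((r : ℂ) • E - g ∘ₗ E + compress E z)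
  have hF (x : B) : F x = (r : ℂ)⁻¹ • ((r : ℂ) • E x - g (E x) + compress E z x) := rfl
  have hFE : F = E := by
    refine hu F ⟨fun a ↦ ?_, fun a x ↦ ?_, fun x a ↦ ?_, fun x ↦ ?_⟩
    · rw [hF, hE.apply_incl, hg, sub_add_cancel, smul_smul, inv_mul_cancel₀ hr', one_smul]
    · rw [hF, hF, hE.left_module, hgl, compress_left_module hE hf hz]
      simp only [mul_add, mul_sub, mul_smul_comm]
    · rw [hF, hF, hE.right_module, hgr, compress_right_module hE hf hz]
      simp only [add_mul, sub_mul, smul_mul_assoc]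
    · obtain ⟨c, hc⟩ := hE.positive x
      obtain ⟨f, hf'⟩ := hE.positive (z.right x)
      -- Since r − d = e* e and d c* c = c* d c, the left side is c* e* e c.
      have h1 : (r : ℂ) • (star c * c) - g (star c * c) = star (e.fst c) * e.fst c := by
        have h2 : ((r : ℂ) • (1 : 𝓜(ℂ, A)) - d).fst c = (star e * e).fst c := by rw [he]
        have h3 : (star e * e).fst c = (star e).fst (e.fst c) := rfl
        have h4 : ((r : ℂ) • (1 : 𝓜(ℂ, A)) - d).fst c = (r : ℂ) • c - g c := by
          rw [← hd1]; rfl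
        rw [h3, h4] at h2
        rw [hgl, ← mul_smul_comm, ← mul_sub, h2, ← (star e).central, DoubleCentralizer.star_snd,
          star_star]
      obtain ⟨c', hc'⟩ := star_mul_self_add_star_mul_self (e.fst c) f
      refine ⟨((√r⁻¹ : ℝ) : ℂ) • c', ?_⟩
      have h5 : ((√r⁻¹ : ℝ) : ℂ) * ((√r⁻¹ : ℝ) : ℂ) = (r : ℂ)⁻¹ := by
        rw [← Complex.ofReal_mul, Real.mul_self_sqrt (inv_nonneg.mpr hr.le), Complex.ofReal_inv]
      rw [hF, hc, h1, compress_star_mul_self hf, hf', hc', star_smul, smul_mul_smul_comm,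
        ← starRingEnd_apply, Complex.conj_ofReal, h5]
  have h1 := congrArg (fun f : B →ₗ[ℂ] A ↦ (r : ℂ) • f x) hFE
  simp only [hF, smul_smul, mul_inv_cancel₀ hr', one_smul] at h1
  rw [sub_add, sub_eq_self, sub_eq_zero] at h1
  exact h1.symm

/-- The multiplier `1 + c z`. -/
def Multiplier.oneAddSmul [IsScalarTower ℂ B B] [SMulCommClass ℂ B B] (c : ℂ) (z : Multiplier B) :
    Multiplier B where
  left := LinearMap.id + c • z.left
  right := LinearMap.id + c • z.right
  central x y := by
    simp [add_mul, mul_add, smul_mul_assoc, mul_smul_comm, z.central]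

theorem apply_right_eq_of_unique [IsScalarTower ℂ B B] [SMulCommClass ℂ B B]
    (hE : IsConditionalExpectation ι E)
    (hf : ∀ x, E (star x * x) = 0 → x = 0)
    (hu : ∀ F : B →ₗ[ℂ] A, IsConditionalExpectation ι F → F = E) {z : Multiplier B}
    (hz : ∀ a y, z.right (y * ι a) = z.right y * ι a) (x : B) :
    E (z.right x) = E (z.right (ι (E x))) := by
  suffices h : ∀ x, E x = 0 → E (z.right x) = 0 by
    have h1 := h (x - ι (E x)) (by rw [map_sub, hE.apply_incl, sub_self])
    rwa [map_sub, map_sub, sub_eq_zero] at h1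
  intro x hx
  -- Polarization: expand E((1 + c z)* x (1 + c z)). For E(x) = 0 this vanishes, as do the terms
  -- E(x) and |c|² E(z* x z), so c E(x z) + c̄ E(z* x) = 0. The values c = 1 and c = i separate the
  -- two terms.
  have key (c : ℂ) : c • E (z.right x) + star c • E (star (z.right (star x))) = 0 := by
    have hzc (a y) : (z.oneAddSmul c).right (y * ι a) = (z.oneAddSmul c).right y * ι a := by
      simp [Multiplier.oneAddSmul, hz, add_mul, smul_mul_assoc]
    have h1 := compress_eq_of_unique hE hf hu hzc x
    have h2 := compress_eq_of_unique hE hf hu hz x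
    rw [hx, map_zero, map_zero, compress_apply] at h1 h2
    simp only [Multiplier.oneAddSmul, LinearMap.add_apply, LinearMap.id_apply,
      LinearMap.smul_apply, star_add, star_smul, map_add, map_smul, star_star, hx, h2] at h1
    simpa [add_comm] using h1
  have k1 := key 1
  have k2 := key Complex.I
  simp only [star_one, one_smul] at k1
  rw [eq_neg_of_add_eq_zero_right k1] at k2
  simp only [Complex.star_def, Complex.conj_I, smul_neg, neg_smul, neg_neg, ← add_smul] at k2
  exact (smul_eq_zero.mp k2).resolve_left (by simp [← two_mul])

/-- If `E` is faithful and the only conditional expectation, then every multiplier `z` that commutes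
with `A` satisfies `E(x z) = E(x) m` for a central multiplier `m` of `A`. -/
theorem exists_central_of_unique [IsScalarTower ℂ B B] [SMulCommClass ℂ B B]
    (hE : IsConditionalExpectation ι E)
    (hf : ∀ x, E (star x * x) = 0 → x = 0)
    (hu : ∀ F : B →ₗ[ℂ] A, IsConditionalExpectation ι F → F = E) {z : Multiplier B}
    (hz : ∀ a y, z.right (y * ι a) = z.right y * ι a) :
    ∃ m ∈ Set.centralizer (Set.range fun a : A ↦ (a : 𝓜(ℂ, A))),
      ∀ x, E (z.right x) = m.snd (E x) := by
  let g : A →ₗ[ℂ] A := E ∘ₗ z.right ∘ₗ (ι : A →ₗ[ℂ] B)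
  have hg (a : A) : g a = E (z.right (ι a)) := rfl
  have hgl (a b : A) : g (a * b) = a * g b := by
    rw [hg, map_mul, z.right_mul hf, hE.left_module, hg]
  have hgr (a b : A) : g (a * b) = g a * b := by
    rw [hg, map_mul, hz, hE.right_module, hg]
  obtain ⟨m, hm1, hm2⟩ := exists_doubleCentralizer g g fun x y ↦ by rw [← hgl, hgr]
  refine ⟨m, (mem_centralizer_iff m).mpr fun a ↦ by rw [hm1, hm2], fun x ↦ ?_⟩
  rw [hm2, hg, apply_right_eq_of_unique hE hf hu hz]

end Expectation

end CStarCoaction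

namespace CStarCoaction

open Coalgebra

/-! ### Elements of A ⊗ H⁰ as linear maps H → A -/

section Slice
variable {H A : Type*} [CStarAlgebra H] [CStarHopfAlgebra H] [FiniteDimensional ℂ H]
    [NonUnitalCStarAlgebra A]

theorem exists_eq_sum_tmul_basis {M N ι : Type*} [AddCommGroup M] [Module ℂ M] [AddCommGroup N]
    [Module ℂ N] [Fintype ι] (b : Module.Basis ι ℂ N) (z : M ⊗[ℂ] N) :
    ∃ f : ι → M, z = ∑ i, f i ⊗ₜ[ℂ] b i := by
  induction z with
  | zero => exact ⟨0, by simp⟩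
  | add x y hx hy =>
    obtain ⟨f, rfl⟩ := hx
    obtain ⟨g, rfl⟩ := hy
    exact ⟨f + g, by simp [TensorProduct.add_tmul, Finset.sum_add_distrib]⟩
  | tmul x y =>
    refine ⟨fun i ↦ b.repr y i • x, ?_⟩
    simp only [TensorProduct.smul_tmul, ← TensorProduct.tmul_sum, b.sum_repr]

/-- An element of `A ⊗ H⁰` is the linear map `H → A` of its slices. -/
theorem exists_slice_eq (f : H →ₗ[ℂ] A) : ∃ x : A ⊗[ℂ] DualHopf H, ∀ h, slice h x = f h := by
  let b := Module.finBasis ℂ H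
  refine ⟨∑ i, f (b i) ⊗ₜ (DualHopf.toDual H).symm (b.coord i), fun h ↦ ?_⟩
  rw [map_sum]
  simp only [slice_tmul]
  conv_rhs => rw [← b.sum_repr h, map_sum]
  simp only [map_smul]
  rfl

theorem slice_ext {x y : A ⊗[ℂ] DualHopf H} (h : ∀ k : H, slice k x = slice k y) : x = y := by
  let b := Module.finBasis ℂ H
  let b' : Module.Basis _ ℂ (DualHopf H) := b.dualBasis.map (DualHopf.toDual H).symm
  obtain ⟨f, hf⟩ := exists_eq_sum_tmul_basis b' (x - y)
  have h1 (i) : f i = 0 := by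
    have h2 : slice (b i) (x - y) = 0 := by rw [map_sub, h, sub_self]
    rw [hf, map_sum] at h2
    simp only [slice_tmul] at h2
    have h3 (j) : b' j (b i) = if j = i then 1 else 0 := by
      change b.dualBasis j (b i) = _
      rw [b.dualBasis_apply_self]
      simp only [eq_comm]
    simpa [h3] using h2
  simp only [h1, TensorProduct.zero_tmul, Finset.sum_const_zero] at hf
  exact sub_eq_zero.mp hf

theorem slice_lTensor_fourier (k h : H) (a : A) :
    slice k ((fourier (H := H)).lTensor A (a ⊗ₜ h)) = fourier h k • a := by
  rw [LinearMap.lTensor_tmul, slice_tmul]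

/-- Tensoring with A over a field keeps the Fourier transform injective, so identities in the
crossed product may be tested by scalar-valued pairings with k. -/
theorem eq_of_slice_fourier {u v : A ⊗[ℂ] H}
    (h : ∀ k, slice k ((fourier (H := H)).lTensor A u) = slice k ((fourier (H := H)).lTensor A v)) :
    u = v :=
  Module.Flat.lTensor_preserves_injective_linearMap _ fourier_injective (slice_ext h)

variable (H) in
/-- The basis of `H⁰` that is the Fourier transform of a basis of `H`. -/
noncomputable def fourierBasis : Module.Basis (Fin (Module.finrank ℂ H)) ℂ (DualHopf H) :=
  (Module.finBasis ℂ H).map (LinearEquiv.ofBijective fourier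
    ⟨fourier_injective, (LinearMap.injective_iff_surjective_of_finrank_eq_finrank
      (by rw [(DualHopf.toDual H).finrank_eq, Subspace.dual_finrank_eq])).mp fourier_injective⟩)

theorem fourierBasis_apply (i) : fourierBasis H i = fourier (Module.finBasis ℂ H i) := by
  rw [fourierBasis, Module.Basis.map_apply]
  rfl

end Slice

namespace Coaction
variable {H A : Type*} [CStarAlgebra H] [CStarHopfAlgebra H] [FiniteDimensional ℂ H]
    [NonUnitalCStarAlgebra A] (ρ : Coaction H A)

/-! ### The canonical conditional expectation -/

theorem incl_mul (a : A) (x : ρ.CrossedProduct) : ρ.incl a * x = leftA (H := H) a x := by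
  change leftA a (ρ.leftH 1 x) = _
  rw [map_one]; rfl

theorem mk_mul (a : A) (h : H) (x : ρ.CrossedProduct) :
    CrossedProduct.mk ρ a h * x = leftA (H := H) a (ρ.leftH h x) := rfl

theorem canonicalExpectation_leftA (a : A) (x : A ⊗[ℂ] H) :
    ρ.canonicalExpectation (leftA a x) = a * ρ.canonicalExpectation x := by
  induction x with
  | zero => erw [map_zero]; exact (mul_zero a).symm
  | add x y hx hy =>
    rw [map_add]
    erw [map_add, map_add]
    rw [mul_add]
    exact congrArg₂ _ hx hy
  | tmul b h =>
    rw [leftA_tmul]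
    refine (ρ.canonicalExpectation_mk _ _).trans ?_
    rw [← mul_smul_comm]
    exact congrArg _ (ρ.canonicalExpectation_mk b h).symm

/-- This computes E((1 ⋊ h)(b ⋊ 1)) = τ(h₂) h₁ · b, and invariance of τ reduces it to τ(h) b. -/
theorem canonicalExpectation_leftH (h : H) (b : A) :
    ρ.canonicalExpectation (ρ.leftH h (b ⊗ₜ 1)) = haar H h • b := by
  rw [ρ.leftH_tmul _ _ _ (ℛ ℂ h)]
  refine (map_sum ρ.canonicalExpectation _ _).trans ?_
  have h1 := congrArg (fun k ↦ ρ.act k b) (sum_haar_right_smul h (ℛ ℂ h))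
  simp only [map_sum, map_smul, LinearMap.sum_apply, LinearMap.smul_apply, act_one] at h1
  rw [← h1]
  refine Finset.sum_congr rfl fun i _ ↦ ?_
  rw [mul_one]
  exact ρ.canonicalExpectation_mk _ _

theorem canonicalExpectation_cstar (x : A ⊗[ℂ] H) :
    ρ.canonicalExpectation (ρ.cstar x) = star (ρ.canonicalExpectation x) := by
  induction x with
  | zero => rw [cstar_zero]; erw [map_zero]; simp
  | add x y hx hy =>
    rw [cstar_add]
    erw [map_add, map_add]
    rw [star_add]
    exact congrArg₂ _ hx hy
  | tmul a h =>
    rw [cstar_tmul, canonicalExpectation_leftH, haar_star]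
    refine Eq.trans ?_ (congrArg star (ρ.canonicalExpectation_mk a h).symm)
    rw [star_smul]; rfl

/-- E is a right module map even over M(A). The right action is defined through the involution, so
the claim reduces to the evident left action. -/
theorem canonicalExpectation_multiplierRight (m : 𝓜(ℂ, A)) (x : A ⊗[ℂ] H) :
    ρ.canonicalExpectation (ρ.multiplierRight m x) = m.snd (ρ.canonicalExpectation x) := by
  have h1 (n : 𝓜(ℂ, A)) (y : A ⊗[ℂ] H) :
      ρ.canonicalExpectation ((n.fst : A →ₗ[ℂ] A).rTensor H y) =
        n.fst (ρ.canonicalExpectation y) := by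
    induction y with
    | zero => rw [map_zero]; erw [map_zero]; exact (map_zero n.fst).symm
    | add x y hx hy =>
      rw [map_add]
      erw [map_add, map_add, map_add]
      exact congrArg₂ _ hx hy
    | tmul a h =>
      refine (ρ.canonicalExpectation_mk _ _).trans ?_
      refine Eq.trans ?_ (congrArg n.fst (ρ.canonicalExpectation_mk a h).symm)
      rw [map_smul]; rfl
  change ρ.canonicalExpectation
    (ρ.cstar (((star m).fst : A →ₗ[ℂ] A).rTensor H (ρ.cstar x))) = _
  rw [canonicalExpectation_cstar, h1, canonicalExpectation_cstar, DoubleCentralizer.star_fst,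
    star_star, star_star]

/-- Every element of `A ⋊ H` is of the form `∑ᵢ (1 ⋊ kᵢ)(bᵢ ⋊ 1)`, for any basis `kᵢ` of `H`. -/
theorem exists_eq_sum_leftH {ι : Type*} [Fintype ι] (k : Module.Basis ι ℂ H) (x : A ⊗[ℂ] H) :
    ∃ b : ι → A, x = ∑ i, ρ.leftH (k i) (b i ⊗ₜ 1) := by
  -- The involution of B sends a* ⋊ h* to (1 ⋊ h)(a ⋊ 1), so an expansion of x* with coefficients on
  -- the left becomes one of x with coefficients on the right.
  obtain ⟨f, hf⟩ := exists_eq_sum_tmul_basis k (star (ρ.cstar x))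
  refine ⟨f, ?_⟩
  rw [← ρ.cstar_cstar x, ← star_star (ρ.cstar x), hf, star_sum, cstar_sum]
  refine Finset.sum_congr rfl fun i _ ↦ ?_
  rw [TensorProduct.star_tmul, cstar_tmul, star_star, star_star]

/-- With x = ∑ᵢ (1 ⋊ kᵢ) bᵢ, the product x* x is ∑ᵢⱼ bᵢ* (1 ⋊ kᵢ* kⱼ) bⱼ, and E replaces kᵢ* kⱼ by
τ(kᵢ* kⱼ). Both positivity and faithfulness of E follow. -/
theorem canonicalExpectation_star_mul_self {n : ℕ} {k : Module.Basis (Fin n) ℂ H}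
    (hk : ∀ i j, haar H (star (k i) * k j) = if i = j then 1 else 0) (b : Fin n → A)
    (x : ρ.CrossedProduct) (hx : x = ∑ i, ρ.leftH (k i) (b i ⊗ₜ 1)) :
    ρ.canonicalExpectation (star x * x) = ∑ i, star (b i) * b i := by
  have h1 : star x = ∑ i, CrossedProduct.mk ρ (star (b i)) (star (k i)) := by
    change ρ.cstar x = _
    rw [hx, cstar_sum]
    refine Finset.sum_congr rfl fun i _ ↦ ?_
    rw [cstar_leftH, cstar_tmul, star_one, map_one, Module.End.one_apply, LinearMap.lTensor_tmul,
      LinearMap.mulRight_apply, one_mul]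
    rfl
  rw [h1, Finset.sum_mul, map_sum]
  refine Finset.sum_congr rfl fun i _ ↦ ?_
  rw [mk_mul]
  refine (ρ.canonicalExpectation_leftA _ _).trans ?_
  congr 1
  rw [hx, map_sum]
  refine (map_sum ρ.canonicalExpectation _ _).trans ?_
  have h2 (j) : ρ.canonicalExpectation (ρ.leftH (star (k i)) (ρ.leftH (k j) (b j ⊗ₜ 1))) =
      if i = j then b j else 0 := by
    rw [← Module.End.mul_apply, ← map_mul, canonicalExpectation_leftH, hk]
    split_ifs <;> simp
  simp only [h2, Finset.sum_ite_eq, Finset.mem_univ, if_true]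

theorem isConditionalExpectation_canonicalExpectation :
    IsConditionalExpectation ρ.incl ρ.canonicalExpectation where
  apply_incl a := (ρ.canonicalExpectation_mk a 1).trans (by rw [haar_one, one_smul])
  left_module a x := by
    rw [incl_mul]
    exact ρ.canonicalExpectation_leftA a x
  right_module x a := by
    have h (y : A ⊗[ℂ] H) : ρ.canonicalExpectation (ρ.mulMap y (a ⊗ₜ 1)) =
        ρ.canonicalExpectation y * a := by
      induction y with
      | zero =>
        rw [map_zero, LinearMap.zero_apply]
        erw [map_zero, zero_mul]
      | add x y hx hy =>
        rw [map_add, LinearMap.add_apply]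
        erw [map_add, map_add]
        rw [add_mul]
        exact congrArg₂ _ hx hy
      | tmul b h =>
        rw [mulMap_tmul, canonicalExpectation_leftA, canonicalExpectation_leftH, mul_smul_comm,
          ← smul_mul_assoc]
        exact congrArg (· * a) (ρ.canonicalExpectation_mk b h).symm
    exact h x
  positive x := by
    obtain ⟨n, k, hk⟩ := exists_haar_orthonormal_basis H
    obtain ⟨b, hb⟩ := ρ.exists_eq_sum_leftH k x
    rw [ρ.canonicalExpectation_star_mul_self hk b x hb]
    exact sum_star_mul_self _ _

theorem canonicalExpectation_faithful (x : ρ.CrossedProduct)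
    (h : ρ.canonicalExpectation (star x * x) = 0) : x = 0 := by
  obtain ⟨n, k, hk⟩ := exists_haar_orthonormal_basis H
  obtain ⟨b, hb⟩ := ρ.exists_eq_sum_leftH k x
  rw [ρ.canonicalExpectation_star_mul_self hk b x hb] at h
  have h0 := eq_zero_of_sum_star_mul_self _ _ h
  rw [hb]
  exact Finset.sum_eq_zero fun i hi ↦ by rw [h0 i hi, TensorProduct.zero_tmul, map_zero]; rfl

end Coaction

end CStarCoaction

namespace CStarCoaction

open Coalgebra

namespace Coaction
variable {H A : Type*} [CStarAlgebra H] [CStarHopfAlgebra H] [FiniteDimensional ℂ H]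
    [NonUnitalCStarAlgebra A] (ρ : Coaction H A)

/-! ### Multipliers of the crossed product -/

variable {ρ} in
theorem multiplier_eq_of_left {z w : Multiplier ρ.CrossedProduct} (h : z.left = w.left) : z = w :=
  Multiplier.ext h <| LinearMap.ext fun x ↦ sub_eq_zero.mp <|
    eq_zero_of_forall_mul_right_eq_zero ρ.canonicalExpectation_faithful fun y ↦ by
      rw [sub_mul, z.central, w.central, h, sub_self]

variable {ρ} in
theorem multiplier_eq_of_right {z w : Multiplier ρ.CrossedProduct} (h : z.right = w.right) :
    z = w :=
  Multiplier.ext (LinearMap.ext fun x ↦ sub_eq_zero.mp <|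
    eq_zero_of_forall_mul_left_eq_zero ρ.canonicalExpectation_faithful fun y ↦ by
      rw [mul_sub, ← z.central, ← w.central, h, sub_self]) h

theorem multiplierMap_mem_centralizer {m : 𝓜(ℂ, A)}
    (hm : m ∈ Set.centralizer (Set.range fun a : A ↦ (a : 𝓜(ℂ, A)))) :
    ρ.multiplierMap m ∈
      Set.centralizer (Set.range fun a : A ↦ Multiplier.ofElement (ρ.incl a)) := by
  rintro - ⟨a, rfl⟩
  have h1 := hm _ ⟨a, rfl⟩
  simp only at h1 ⊢
  rw [← multiplierMap_coe, ← multiplierMap_mul, ← multiplierMap_mul, h1]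

theorem centralizer_eq_of_unique
    (hu : ∀ F : ρ.CrossedProduct →ₗ[ℂ] A,
      IsConditionalExpectation ρ.incl F → F = ρ.canonicalExpectation) :
    Set.centralizer (Set.range fun a : A ↦ Multiplier.ofElement (ρ.incl a)) =
      ρ.multiplierMap '' Set.centralizer (Set.range fun a : A ↦ (a : 𝓜(ℂ, A))) := by
  refine Set.Subset.antisymm (fun z hz ↦ ?_) ?_
  · have hE := ρ.isConditionalExpectation_canonicalExpectation
    have hf := ρ.canonicalExpectation_faithful
    have hz' (a : A) (y : ρ.CrossedProduct) :
        z.right (y * ρ.incl a) = z.right y * ρ.incl a :=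
      congrArg (fun w : Multiplier ρ.CrossedProduct ↦ w.right y) (hz _ ⟨a, rfl⟩)
    obtain ⟨m, hm, hmz⟩ := exists_central_of_unique hE hf hu hz'
    -- For all u, E(u (x z)) = E(u x) m = E(u (x m)); faithfulness gives x z = x m.
    refine ⟨m, hm, (multiplier_eq_of_right <| LinearMap.ext fun x ↦ sub_eq_zero.mp <|
      eq_zero_of_forall_apply_mul_eq_zero hf fun u ↦ ?_).symm⟩
    rw [mul_sub, ← Multiplier.right_mul hf, ← Multiplier.right_mul hf, map_sub, hmz, sub_eq_zero]
    exact (ρ.canonicalExpectation_multiplierRight m _).symm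
  · rintro - ⟨m, hm, rfl⟩
    exact ρ.multiplierMap_mem_centralizer hm

/-! ### Freeness -/

/-- With x viewed as a map H → M(A), the relation becomes x(k₁)(k₂ · a) = a x(k). Both implications
1 → 3 and 2 → 1 work with this form. -/
theorem free_condition_iff (x : 𝓜(ℂ, A) ⊗[ℂ] DualHopf H) (a : A) :
    (x * ((DoubleCentralizer.coeHom : A →⋆ₙₐ[ℂ] 𝓜(ℂ, A)) : A →ₗ[ℂ] 𝓜(ℂ, A)).rTensor
        (DualHopf H) (ρ.hom a) = ((a : 𝓜(ℂ, A)) ⊗ₜ[ℂ] (1 : DualHopf H)) * x) ↔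
      ∀ k : H, ∑ i ∈ (ℛ ℂ k).index, slice ((ℛ ℂ k).left i) x *
        ((ρ.act ((ℛ ℂ k).right i) a : A) : 𝓜(ℂ, A)) = (a : 𝓜(ℂ, A)) * slice k x := by
  have h1 (k : H) (y : A ⊗[ℂ] DualHopf H) :
      slice k (((DoubleCentralizer.coeHom : A →⋆ₙₐ[ℂ] 𝓜(ℂ, A)) : A →ₗ[ℂ] 𝓜(ℂ, A)).rTensor
        (DualHopf H) y) = ((slice k y : A) : 𝓜(ℂ, A)) := by
    change _ = ((DoubleCentralizer.coeHom : A →⋆ₙₐ[ℂ] 𝓜(ℂ, A)) : A →ₗ[ℂ] 𝓜(ℂ, A)) (slice k y)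
    induction y with
    | zero => simp only [map_zero]
    | add x y hx hy => simp only [map_add, hx, hy]
    | tmul b φ => rw [LinearMap.rTensor_tmul, slice_tmul, slice_tmul, map_smul]
  have h2 (k : H) : slice k (((a : 𝓜(ℂ, A)) ⊗ₜ[ℂ] (1 : DualHopf H)) * x) =
      (a : 𝓜(ℂ, A)) * slice k x := by
    rw [slice_mul_tmul k _ _ (ℛ ℂ k)]
    simp only [slice_tmul, DualHopf.one_apply, smul_mul_assoc, ← mul_smul_comm,
      ← slice_smul_left, ← Finset.mul_sum]
    let s : H →ₗ[ℂ] 𝓜(ℂ, A) :=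
      { toFun := fun h ↦ slice h x
        map_add' := fun h k ↦ slice_add_left h k x
        map_smul' := fun c h ↦ slice_smul_left c h x }
    have h3 := congrArg s (sum_counit_smul (ℛ ℂ k))
    rw [map_sum] at h3
    exact congrArg _ h3
  constructor
  · intro h k
    have h4 := congrArg (slice k) h
    rw [slice_mul_tmul k _ _ (ℛ ℂ k), h2] at h4
    simpa only [h1, act_apply] using h4
  · intro h
    refine slice_ext fun k ↦ ?_
    rw [slice_mul_tmul k _ _ (ℛ ℂ k), h2]
    simpa only [h1, act_apply] using h k

theorem coe_act_star (h : H) (a : A) :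
    star ((ρ.act (star (CStarHopfAlgebra.antipode h)) (star a) : A) : 𝓜(ℂ, A)) =
      ((ρ.act h a : A) : 𝓜(ℂ, A)) := by
  rw [← star_act]
  have := map_star (DoubleCentralizer.coeHom : A →⋆ₙₐ[ℂ] 𝓜(ℂ, A)) (ρ.act h a)
  exact (congrArg star this).trans (star_star _)

/-- A conditional expectation `F` onto `A` defines multipliers `m_k = F(1 ⋊ k)` of `A`. -/
theorem exists_multiplier_of_isConditionalExpectation {F : ρ.CrossedProduct →ₗ[ℂ] A}
    (hF : IsConditionalExpectation ρ.incl F) :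
    ∃ m : H →ₗ[ℂ] 𝓜(ℂ, A), (∀ k a, (m k).fst a = F (ρ.leftH k (a ⊗ₜ 1))) ∧
      ∀ k a, (m k).snd a = F (a ⊗ₜ[ℂ] k) := by
  have h1 (k : H) : ∃ m : 𝓜(ℂ, A), (∀ a, m.fst a = F (ρ.leftH k (a ⊗ₜ 1))) ∧
      ∀ a, m.snd a = F (a ⊗ₜ[ℂ] k) := by
    refine exists_doubleCentralizer
      ((F : A ⊗[ℂ] H →ₗ[ℂ] A) ∘ₗ ρ.leftH k ∘ₗ (TensorProduct.mk ℂ A H).flip 1)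
      ((F : A ⊗[ℂ] H →ₗ[ℂ] A) ∘ₗ (TensorProduct.mk ℂ A H).flip k) fun a b ↦ ?_
    have h2 := hF.right_module (CrossedProduct.mk ρ a k) b
    have h3 := hF.left_module a (ρ.leftH k (b ⊗ₜ 1) : A ⊗[ℂ] H)
    exact h2.symm.trans ((congrArg F (ρ.incl_mul a _)).symm.trans h3)
  choose m hm1 hm2 using h1
  refine ⟨{ toFun := m, map_add' := fun k l ↦ ?_, map_smul' := fun c k ↦ ?_ }, hm1, hm2⟩
  · refine doubleCentralizer_ext_fst fun a ↦ ?_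
    rw [hm1, map_add, LinearMap.add_apply, DoubleCentralizer.add_fst,
      add_apply, hm1, hm1]
    exact map_add F _ _
  · refine doubleCentralizer_ext_fst fun a ↦ ?_
    rw [hm1, map_smul, LinearMap.smul_apply, RingHom.id_apply, DoubleCentralizer.smul_fst,
      smul_apply, hm1]
    exact map_smul F _ _

theorem IsFree.unique (hρ : ρ.IsFree) {F : ρ.CrossedProduct →ₗ[ℂ] A}
    (hF : IsConditionalExpectation ρ.incl F) : F = ρ.canonicalExpectation := by
  obtain ⟨m, hm1, hm2⟩ := ρ.exists_multiplier_of_isConditionalExpectation hF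
  -- F is applied to (1 ⋊ k)(a ⋊ 1) = ∑ (k₁ · a) ⋊ k₂.
  have hm3 (k : H) (a : A) {κ : Type _} (r : Repr ℂ k κ) : m k * (a : 𝓜(ℂ, A)) =
      ∑ i ∈ r.index, ((ρ.act (r.left i) a : A) : 𝓜(ℂ, A)) * m (r.right i) := by
    simp only [doubleCentralizer_mul_coe, doubleCentralizer_coe_mul, hm1, hm2]
    rw [ρ.leftH_tmul _ _ _ r]
    have h1 := map_sum ((DoubleCentralizer.coeHom : A →⋆ₙₐ[ℂ] 𝓜(ℂ, A)) : A →ₗ[ℂ] 𝓜(ℂ, A))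
      (fun i ↦ F (ρ.act (r.left i) a ⊗ₜ[ℂ] r.right i)) r.index
    have h2 := map_sum F (fun i ↦ (ρ.act (r.left i) a ⊗ₜ[ℂ] r.right i : A ⊗[ℂ] H)) r.index
    have h3 : ∑ i ∈ r.index, ρ.act (r.left i) a ⊗ₜ[ℂ] (r.right i * 1) =
        ∑ i ∈ r.index, ρ.act (r.left i) a ⊗ₜ[ℂ] r.right i := by simp only [mul_one]
    exact (congrArg (fun u : A ↦ (u : 𝓜(ℂ, A))) ((congrArg F h3).trans h2)).trans h1
  have hm4 : m 1 = 1 := doubleCentralizer_ext_fst fun a ↦ by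
    rw [hm1, map_one]
    exact hF.apply_incl a
  -- These are the slices of the adjoint, in M(A) ⊗ H⁰, of the element with slices m_k. Taking
  -- adjoints moves the action of H to the side required by freeness.
  let f : H →ₗ[ℂ] 𝓜(ℂ, A) :=
    { toFun := fun h ↦ star (m (star (CStarHopfAlgebra.antipode h)))
      map_add' := fun h k ↦ by simp
      map_smul' := fun c h ↦ by simp }
  obtain ⟨x, hx⟩ := exists_slice_eq f
  -- The commutation rule for m at S(k)* and a*, followed by the adjoint; S reverses Δ, which puts
  -- k₁ and k₂ in the right places.
  obtain ⟨n, -, hn⟩ := hρ x fun a ↦ (ρ.free_condition_iff x a).mpr fun k ↦ by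
    have h1 := congrArg star (hm3 _ (star a) (reprStarAntipode k))
    have h2 : star ((star a : A) : 𝓜(ℂ, A)) = a := by
      have := map_star (DoubleCentralizer.coeHom : A →⋆ₙₐ[ℂ] 𝓜(ℂ, A)) a
      exact (congrArg star this).trans (star_star _)
    rw [star_mul, star_sum, h2] at h1
    simp only [hx]
    refine Eq.trans ?_ h1.symm
    refine Finset.sum_congr rfl fun i _ ↦ ?_
    rw [star_mul]
    exact congrArg _ (ρ.coe_act_star _ a).symm
  have hfn (h : H) : f h = haar H h • n := by rw [← hx, hn, slice_tmul]
  have hn1 : n = 1 := by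
    have h1 := hfn 1
    rw [haar_one, one_smul] at h1
    rw [← h1]
    change star (m (star (CStarHopfAlgebra.antipode 1))) = 1
    rw [antipode_one', star_one, hm4, star_one]
  -- Every k has the form S(h)*, and τ is invariant under S and compatible with the involution.
  have hmk (k : H) : m k = haar H k • 1 := by
    obtain ⟨h, hh⟩ := LinearMap.surjective_of_injective (antipode_injective H) (star k)
    have h1 := congrArg star (hfn h)
    change star (star (m (star (CStarHopfAlgebra.antipode h)))) = _ at h1
    rw [hh, star_star, star_star, star_smul, hn1, star_one, ← haar_antipode, hh, haar_star,
      ← starRingEnd_apply, Complex.conj_conj] at h1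
    exact h1
  refine LinearMap.ext fun y ↦ ?_
  obtain ⟨b, hb⟩ := ρ.exists_eq_sum_leftH (Module.finBasis ℂ H) y
  rw [hb]
  refine (map_sum F _ _).trans (Eq.trans ?_ (map_sum ρ.canonicalExpectation _ _).symm)
  refine Finset.sum_congr rfl fun i _ ↦ ?_
  rw [canonicalExpectation_leftH, ← hm1, hmk]
  rfl

/-- The multiplier `∑ᵢ mᵢ ⋊ kᵢ` of `A ⋊ H`. -/
noncomputable def sumMultiplier {ι : Type*} [Fintype ι] (m : ι → 𝓜(ℂ, A)) (k : ι → H) :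
    Multiplier ρ.CrossedProduct where
  left := (∑ i, ((m i).fst : A →ₗ[ℂ] A).rTensor H ∘ₗ ρ.leftH (k i) : A ⊗[ℂ] H →ₗ[ℂ] A ⊗[ℂ] H)
  right := (∑ i, (LinearMap.mulRight ℂ (k i)).lTensor A ∘ₗ ρ.multiplierRight (m i) :
    A ⊗[ℂ] H →ₗ[ℂ] A ⊗[ℂ] H)
  central x y := by
    have h (x y : A ⊗[ℂ] H) : ρ.mulMap
        ((∑ i, (LinearMap.mulRight ℂ (k i)).lTensor A ∘ₗ ρ.multiplierRight (m i) :
          A ⊗[ℂ] H →ₗ[ℂ] A ⊗[ℂ] H) x) y =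
        ρ.mulMap x ((∑ i, ((m i).fst : A →ₗ[ℂ] A).rTensor H ∘ₗ ρ.leftH (k i) :
          A ⊗[ℂ] H →ₗ[ℂ] A ⊗[ℂ] H) y) := by
      simp only [LinearMap.sum_apply, map_sum, LinearMap.comp_apply, mulMap_mulRight]
      exact Finset.sum_congr rfl fun i _ ↦ ρ.multiplierMap_central (m i) x _
    exact h x y

theorem isFree_of_centralizer_subset
    (h : Set.centralizer (Set.range fun a : A ↦ Multiplier.ofElement (ρ.incl a)) ⊆
      ρ.multiplierMap '' Set.centralizer (Set.range fun a : A ↦ (a : 𝓜(ℂ, A)))) : ρ.IsFree := by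
  intro x hx
  let b := Module.finBasis ℂ H
  obtain ⟨m, hm⟩ := exists_eq_sum_tmul_basis (fourierBasis H) x
  simp only [fourierBasis_apply] at hm
  have hslice (k : H) : slice k x = ∑ i, fourier (b i) k • m i := by
    rw [hm, map_sum]
    simp only [slice_tmul]
    rfl
  -- This is z a = a z for z = ∑ᵢ mᵢ ⋊ bᵢ. After the Fourier transform, `sum_fourier_smul` trades
  -- the coproduct of bᵢ for that of k, and what remains is the pointwise relation for x.
  have key (a : A) : ∑ i, ((m i).fst : A →ₗ[ℂ] A).rTensor H (ρ.leftH (b i) (a ⊗ₜ 1)) =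
      ∑ i, (m i).snd a ⊗ₜ[ℂ] b i := by
    refine eq_of_slice_fourier fun k ↦ doubleCentralizer_coe_injective ?_
    have h1 := (ρ.free_condition_iff x a).mp (hx a) k
    let c : A →ₗ[ℂ] 𝓜(ℂ, A) := ((DoubleCentralizer.coeHom : A →⋆ₙₐ[ℂ] 𝓜(ℂ, A)) : A →ₗ[ℂ] 𝓜(ℂ, A))
    have hc (a : A) : (a : 𝓜(ℂ, A)) = c a := rfl
    simp only [hslice, Finset.mul_sum, Finset.sum_mul, mul_smul_comm, smul_mul_assoc,
      doubleCentralizer_mul_coe, doubleCentralizer_coe_mul] at h1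
    simp only [hc] at h1
    simp only [hc, map_sum, slice_lTensor_fourier, map_smul]
    rw [← h1, Finset.sum_comm]
    refine Finset.sum_congr rfl fun i _ ↦ ?_
    have h2 := congrArg (c ∘ₗ ((m i).fst : A →ₗ[ℂ] A) ∘ₗ ρ.act.flip a)
      (sum_fourier_smul (b i) k (ℛ ℂ (b i)) (ℛ ℂ k))
    simp only [map_sum, map_smul, LinearMap.comp_apply, LinearMap.flip_apply] at h2
    refine Eq.trans ?_ h2
    rw [ρ.leftH_tmul _ _ _ (ℛ ℂ (b i))]
    simp only [map_sum, LinearMap.rTensor_tmul, slice_lTensor_fourier, mul_one, map_smul]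
  let z := ρ.sumMultiplier m b
  have hzl (y : A ⊗[ℂ] H) : z.left y =
      ∑ i, ((m i).fst : A →ₗ[ℂ] A).rTensor H (ρ.leftH (b i) y) := by
    change (∑ i, ((m i).fst : A →ₗ[ℂ] A).rTensor H ∘ₗ ρ.leftH (b i) :
      A ⊗[ℂ] H →ₗ[ℂ] A ⊗[ℂ] H) y = _
    rw [LinearMap.sum_apply]
    rfl
  have hzt (a : A) (k : H) : z.left (a ⊗ₜ[ℂ] k : A ⊗[ℂ] H) = ∑ i, (m i).snd a ⊗ₜ[ℂ] (b i * k) := by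
    have h1 := congrArg ((LinearMap.mulRight ℂ k).lTensor A) (key a)
    simp only [map_sum, LinearMap.lTensor_tmul, LinearMap.mulRight_apply] at h1
    rw [hzl, ← h1]
    refine Finset.sum_congr rfl fun i _ ↦ ?_
    have h2 : a ⊗ₜ[ℂ] k = (LinearMap.mulRight ℂ k).lTensor A (a ⊗ₜ[ℂ] (1 : H)) := by
      rw [LinearMap.lTensor_tmul, LinearMap.mulRight_apply, one_mul]
    have h3 (y : A ⊗[ℂ] H) : ((m i).fst : A →ₗ[ℂ] A).rTensor H
        ((LinearMap.mulRight ℂ k).lTensor A y) = (LinearMap.mulRight ℂ k).lTensor A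
          (((m i).fst : A →ₗ[ℂ] A).rTensor H y) := by
      rw [← LinearMap.comp_apply, ← LinearMap.comp_apply, LinearMap.rTensor_comp_lTensor,
        LinearMap.lTensor_comp_rTensor]
    rw [h2, leftH_mulRight]
    exact h3 _
  -- The commutation on all of B, obtained from its value on simple tensors because the right action
  -- of each mᵢ on A commutes with left multiplication by a.
  have hzA (a : A) (y : A ⊗[ℂ] H) : z.left (leftA a y) = leftA (H := H) a (z.left y) := by
    induction y with
    | zero => rw [map_zero]; erw [map_zero, map_zero]; rfl
    | add x y hx hy =>
      rw [map_add]
      erw [map_add, map_add, map_add]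
      exact congrArg₂ _ hx hy
    | tmul c k =>
      rw [leftA_tmul, hzt, hzt, map_sum]
      refine Finset.sum_congr rfl fun i _ ↦ ?_
      rw [leftA_tmul]
      congr 1
      refine eq_of_forall_mul_eq' fun d ↦ ?_
      rw [(m i).central, mul_assoc, mul_assoc, (m i).central]
  obtain ⟨n, hn, hnz⟩ := h (a := z) (by
    rintro - ⟨a, rfl⟩
    refine multiplier_eq_of_left (LinearMap.ext fun y ↦ ?_)
    refine (ρ.incl_mul a (z.left y)).trans ((hzA a y).symm.trans ?_)
    exact congrArg z.left (ρ.incl_mul a y).symm)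
  -- Now z = n gives n a ⊗ 1 = ∑ᵢ a mᵢ ⊗ bᵢ. Its Fourier transform at k is a times the claim,
  -- because 1 transforms to τ.
  refine ⟨n, hn, slice_ext fun k ↦ sub_eq_zero.mp (eq_zero_of_coe_mul_eq_zero fun a ↦ ?_)⟩
  have h1 : n.fst a ⊗ₜ[ℂ] (1 : H) = ∑ i, (m i).snd a ⊗ₜ[ℂ] b i := by
    have h2 := hzt a 1
    rw [← hnz] at h2
    simp only [mul_one] at h2
    exact h2
  have h3 := congrArg (fun y ↦ slice k ((fourier (H := H)).lTensor A y)) h1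
  simp only [map_sum, slice_lTensor_fourier, fourier_one] at h3
  rw [(mem_centralizer_iff n).mp hn] at h3
  rw [mul_sub, sub_eq_zero, hslice, slice_tmul, doubleCentralizer_coe_mul,
    doubleCentralizer_coe_mul]
  congr 1
  refine Eq.trans ?_ h3.symm
  let S : 𝓜(ℂ, A) →ₗ[ℂ] A :=
    { toFun := fun m ↦ m.snd a
      map_add' := fun _ _ ↦ rfl
      map_smul' := fun _ _ ↦ rfl }
  have h4 := map_sum S (fun i ↦ fourier (b i) k • m i) Finset.univ
  simp only [map_smul] at h4
  exact h4

end Coaction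

end CStarCoaction

theorem mainTheorem1 {H A : Type*} [CStarAlgebra H] [CStarHopfAlgebra H] [FiniteDimensional ℂ H]
    [NonUnitalCStarAlgebra A] (ρ : Coaction H A) :
    List.TFAE [
      ρ.IsFree,
      Set.centralizer (Set.range fun a : A ↦ Multiplier.ofElement (ρ.incl a)) =
        ρ.multiplierMap '' Set.centralizer (Set.range fun a : A ↦ (a : 𝓜(ℂ, A))),
      ∀ F : ρ.CrossedProduct →ₗ[ℂ] A,
        IsConditionalExpectation ρ.incl F ↔ F = ρ.canonicalExpectation] := by
  tfae_have 1 → 3 := fun h F ↦ ⟨fun hF ↦ h.unique ρ hF, fun hF ↦ by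
    rw [hF]; exact ρ.isConditionalExpectation_canonicalExpectation⟩
  tfae_have 3 → 2 := fun h ↦ ρ.centralizer_eq_of_unique fun F hF ↦ (h F).mp hF
  -- Only the inclusion ⊆ carries information; the reverse one holds for every ρ by
  -- `multiplierMap_mem_centralizer`.
  tfae_have 2 → 1 := fun h ↦ ρ.isFree_of_centralizer_subset h.subset
  tfae_finish
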